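/- Let $q=p^m$ with $p$ prime and $m\ge 1$, and let $\mathbb F_q$ be the field with $q$ elements. For $k\in\{3,4\}$ put $R_k=\{x^k : x\in\mathbb F_q^*\}$. Let $\Gamma(k,q)$ be the Cayley graph on $\mathbb F_q$ with an edge from $v$ to $w$ iff $w-v\in R_k$; let $\Gamma^+(k,q)$ be the Cayley sum graph on $\mathbb F_q$ with an edge from $v$ to $w$ iff $v+w\in R_k$ (loops allowed); and let $\overline{\Gamma}(k,q)$ be the (loopless) complement of $\Gamma(k,q)$. The spectrum of a graph is the multiset of eigenvalues of its adjacency matrix, and its energy is the sum of the absolute values of these eigenvalues, counted with multiplicity. Two graphs are isospectral if they have the same spectrum and equienergetic if they have the same energy. For $k>2$, the pair $(k,q)$ is called semiprimitive if $m$ is even, $k\mid p^t+1$ for some $t\ge 1$ with $t\mid \frac m2$, and $k\ne p^{m/2}+1$. (i) Suppose that $3\mid\frac{q-1}{p-1}$ and that $(3,q)$ is not semiprimitive. Let $a,b$ be integers with $$4\sqrt[3]{q}=a^2+27b^2,\qquad a\equiv 1 \pmod 3,\qquad \gcd(a,p)=1.$$ If $a>9|b|$, or if $a<0$ and $-a<9|b|$,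 then the three graphs $\Gamma(3,q)$, $\Gamma^+(3,q)$, $\overline{\Gamma}(3,q)$ are mutually equienergetic and mutually non-isospectral. (ii) Suppose that $4\mid\frac{q-1}{p-1}$ and that $(4,q)$ is not semiprimitive. Let $c,d$ be integers with $$\sqrt{q}=c^2+4d^2,\qquad c\equiv 1 \pmod 4,\qquad \gcd(c,p)=1.$$ If $2|c|<\sqrt[4]{q}<4|d|$, then the three graphs $\Gamma(4,q)$, $\Gamma^+(4,q)$, $\overline{\Gamma}(4,q)$ are mutually equienergetic and mutually non-isospectral. In particular, this holds whenever $|c|<\frac{2\sqrt 3}{3}\,|d|$. -/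

import Mathlib

namespace GPaley

/-- The Cayley graph `X(G, S)`: an arrow from `v` to `w` whenever `w - v ∈ S`. -/
def cayley {G : Type*} [AddCommGroup G] (S : Set G) : Digraph G where
  Adj v w := w - v ∈ S

/-- The Cayley sum graph `X⁺(G, S)`: an arrow from `v` to `w` whenever `v + w ∈ S`
(loops are allowed). -/
def cayleySum {G : Type*} [AddCommGroup G] (S : Set G) : Digraph G where
  Adj v w := v + w ∈ S

/-- The (loopless) complement of a graph: distinct vertices are adjacent exactly when they are
not adjacent in the original graph. (Mathlib's `Gᶜ` for digraphs would also add loops.) -/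
def compl {V : Type*} (Γ : Digraph V) : Digraph V where
  Adj v w := v ≠ w ∧ ¬ Γ.Adj v w

/-- `R_k`, the set of nonzero `k`-th powers of the field `F`. -/
def powerSet (k : ℕ) (F : Type*) [Field F] : Set F :=
  {y | ∃ x : F, x ≠ 0 ∧ y = x ^ k}

/-- The generalized Paley graph `Γ(k, q)`, where `F` is the field with `q` elements. -/
def gp (k : ℕ) (F : Type*) [Field F] : Digraph F :=
  cayley (powerSet k F)

/-- The generalized Paley sum graph `Γ⁺(k, q)`, where `F` is the field with `q` elements. -/
def gpSum (k : ℕ) (F : Type*) [Field F] : Digraph F :=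
  cayleySum (powerSet k F)

open Classical in
/-- The adjacency matrix of a finite digraph. -/
noncomputable def adjMatrix {V : Type*} (Γ : Digraph V) : Matrix V V ℂ :=
  Matrix.of fun v w => if Γ.Adj v w then 1 else 0

open Classical in
/-- The spectrum of a finite digraph: the eigenvalues of its adjacency matrix, counted with
(algebraic) multiplicity. -/
noncomputable def spectrum {V : Type*} [Fintype V] (Γ : Digraph V) : Multiset ℂ :=
  (adjMatrix Γ).charpoly.roots

/-- The energy of a graph: the sum of the absolute values of its eigenvalues. -/
noncomputable def energy {V : Type*} [Fintype V] (Γ : Digraph V) : ℝ :=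
  ((spectrum Γ).map fun z => ‖z‖).sum

/-- Two graphs on the same vertex set are equienergetic and non-isospectral. -/
def EquienergeticNonIsospectral {V : Type*} [Fintype V] (Γ₁ Γ₂ : Digraph V) : Prop :=
  energy Γ₁ = energy Γ₂ ∧ spectrum Γ₁ ≠ spectrum Γ₂

/-- The graphs `Γ(k, q)`, `Γ⁺(k, q)` and the complement of `Γ(k, q)` are mutually equienergetic
and mutually non-isospectral. -/
def TripleEquienergeticNonIsospectral (k : ℕ) (F : Type*) [Field F] [Fintype F] : Prop :=
  EquienergeticNonIsospectral (gp k F) (gpSum k F) ∧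
  EquienergeticNonIsospectral (gp k F) (compl (gp k F)) ∧
  EquienergeticNonIsospectral (gpSum k F) (compl (gp k F))

/-- For `k > 2`, the pair `(k, p ^ m)` is semiprimitive if `k ∣ p ^ t + 1` for some `t ≥ 1`
such that `t ∣ m / 2` (with `m` even), and `k ≠ p ^ (m / 2) + 1`. -/
def IsSemiprimitivePair (k p m : ℕ) : Prop :=
  (∃ t : ℕ, 1 ≤ t ∧ 2 * t ∣ m ∧ k ∣ p ^ t + 1) ∧ k ≠ p ^ (m / 2) + 1

end GPaley

namespace GPaley

open Matrix Polynomial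

/-! ### Characteristic roots and energy -/

section Spectrum

variable {V : Type*} [Fintype V]

/-- The characteristic roots of a square are the squares of the characteristic roots. -/
theorem roots_charpoly_mul_self [DecidableEq V] (M : Matrix V V ℂ) :
    (M * M).charpoly.roots = M.charpoly.roots.map fun z => z * z := by
  have hM : M.charpoly = (M.charpoly.roots.map fun z => X - C z).prod :=
    (IsAlgClosed.splits _).eq_prod_roots_of_monic M.charpoly_monic
  have h : (M * M).charpoly = ((M.charpoly.roots.map fun z => z * z).map fun z => X - C z).prod := by
    -- Evaluating at t = y² factors det(y² - M²) as det(y - M) det(y + M).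
    refine Polynomial.funext fun t => ?_
    obtain ⟨y, rfl⟩ := IsAlgClosed.exists_pow_nat_eq t (n := 2) two_pos
    have hfac : scalar V (y ^ 2) - M * M = (scalar V y - M) * (scalar V y + M) := by
      have : Commute (scalar V y) M := scalar_commute y (fun _ => Commute.all _ _) M
      rw [mul_add, sub_mul, sub_mul, ← this.eq, pow_two, map_mul]
      abel
    have hneg : scalar V y + M = -(scalar V (-y) - M) := by
      rw [map_neg]; abel
    have hroots : ∀ x : ℂ, (scalar V x - M).det = (M.charpoly.roots.map fun z => x - z).prod := by
      intro x
      rw [← eval_charpoly]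
      conv_lhs => rw [hM]
      rw [eval_multiset_prod, Multiset.map_map]
      simp
    have hcard : Multiset.card M.charpoly.roots = Fintype.card V := by
      rw [← (IsAlgClosed.splits M.charpoly).natDegree_eq_card_roots, charpoly_natDegree_eq_dim]
    rw [eval_charpoly, hfac, det_mul, hneg, det_neg, hroots, hroots, eval_multiset_prod,
      Multiset.map_map, Multiset.map_map, ← hcard,
      ← Multiset.prod_replicate, ← Multiset.map_const', ← Multiset.prod_map_mul,
      ← Multiset.prod_map_mul]
    congr 1
    refine Multiset.map_congr rfl fun z _ => ?_
    simp
    ring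
  rw [h, roots_multiset_prod_X_sub_C]

/-- The energy only depends on the square of the adjacency matrix. -/
theorem energy_eq_of_sq_eq {Γ₁ Γ₂ : Digraph V}
    (h : adjMatrix Γ₁ * adjMatrix Γ₁ = adjMatrix Γ₂ * adjMatrix Γ₂) : energy Γ₁ = energy Γ₂ := by
  classical
  have key : ∀ Γ : Digraph V, energy Γ =
      (((adjMatrix Γ * adjMatrix Γ).charpoly.roots).map fun z => √‖z‖).sum := by
    intro Γ
    rw [roots_charpoly_mul_self, Multiset.map_map, energy, spectrum]
    congr 1
    convert rfl using 2
    simp [Real.sqrt_mul_self]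
  rw [key, key, h]

theorem spectrum_sum_eq_trace (Γ : Digraph V) : (spectrum Γ).sum = (adjMatrix Γ).trace := by
  classical
  rw [trace_eq_sum_roots_charpoly, spectrum]

end Spectrum

/-! ### Spectra and energies of Cayley graphs, sum graphs and complements -/

section Cayley

variable {F : Type*} [Field F]

open Classical in
theorem adjMatrix_cayley_apply (S : Set F) (v w : F) :
    adjMatrix (cayley S) v w = if w - v ∈ S then 1 else 0 := rfl

open Classical in
theorem adjMatrix_cayleySum_apply (S : Set F) (v w : F) :
    adjMatrix (cayleySum S) v w = if v + w ∈ S then 1 else 0 := rfl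

theorem compl_cayley (S : Set F) : compl (cayley S) = cayley {x | x ≠ 0 ∧ x ∉ S} := by
  ext v w
  simp [compl, cayley, sub_eq_zero, eq_comm]

variable [Fintype F]

open Classical in
/-- The sum of the character `x ↦ ψ (c * x)` over `S`. -/
noncomputable def charSum (ψ : AddChar F ℂ) (S : Set F) (c : F) : ℂ :=
  ∑ s with s ∈ S, ψ (c * s)

theorem charSum_eq_sum (ψ : AddChar F ℂ) (S : Set F) [DecidablePred (· ∈ S)] (c : F) :
    charSum ψ S c = ∑ s with s ∈ S, ψ (c * s) := by
  unfold charSum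
  congr!

theorem card_filter_mem {α : Type*} [Fintype α] (S : Set α) [DecidablePred (· ∈ S)] :
    (Finset.univ.filter (· ∈ S)).card = S.ncard := by
  rw [← Set.ncard_coe_finset]
  simp

/-- The characters v ↦ ψ(cv) are common eigenvectors of all Cayley graphs. They form the columns of
`P`, and orthogonality of characters makes `P'` its inverse. -/
theorem spectrum_cayley {ψ : AddChar F ℂ} (hψ : ψ.IsPrimitive) (S : Set F) :
    spectrum (cayley S) = Finset.univ.val.map (charSum ψ S) := by
  classical
  set P : Matrix F F ℂ := of fun v c => ψ (c * v) with hP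
  set P' : Matrix F F ℂ := of fun c v => (Fintype.card F : ℂ)⁻¹ * ψ (-(c * v)) with hP'
  have hq : (Fintype.card F : ℂ) ≠ 0 := by simp
  have hPP' : P * P' = 1 := by
    ext v w
    have h := AddChar.sum_mulShift (v - w) hψ
    simp only [hP, hP', mul_apply, of_apply, one_apply]
    have : ∀ c : F, ψ (c * v) * ((Fintype.card F : ℂ)⁻¹ * ψ (-(c * w)))
        = (Fintype.card F : ℂ)⁻¹ * ψ (c * (v - w)) := by
      intro c
      rw [mul_sub, sub_eq_add_neg, AddChar.map_add_eq_mul]; ring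
    simp_rw [this]
    rw [← Finset.mul_sum, h]
    by_cases hvw : v = w
    · simp [hvw, hq]
    · simp [hvw, sub_eq_zero]
  have hAP : adjMatrix (cayley S) * P = P * diagonal (charSum ψ S) := by
    ext v c
    rw [mul_diagonal, mul_apply]
    simp only [adjMatrix_cayley_apply, hP, of_apply, charSum, Finset.mul_sum, Finset.sum_filter]
    refine Fintype.sum_equiv (Equiv.subRight v) _ _ fun w => ?_
    simp only [Equiv.subRight_apply]
    split_ifs
    · rw [one_mul, ← AddChar.map_add_eq_mul]; congr 1; ring
    · simp
  have hchar : (adjMatrix (cayley S)).charpoly = (diagonal (charSum ψ S)).charpoly := by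
    calc (adjMatrix (cayley S)).charpoly = (adjMatrix (cayley S) * P * P').charpoly := by
          rw [mul_assoc, hPP', mul_one]
      _ = (P' * (P * diagonal (charSum ψ S))).charpoly := by rw [hAP, charpoly_mul_comm]
      _ = _ := by rw [← mul_assoc, mul_eq_one_comm.mp hPP', one_mul]
  have : spectrum (cayley S) = (diagonal (charSum ψ S)).charpoly.roots := by
    rw [← hchar, spectrum]
  rw [this, charpoly_diagonal]
  conv_rhs => rw [← roots_multiset_prod_X_sub_C (Multiset.map _ _), Multiset.map_map]
  rfl

theorem energy_cayley {ψ : AddChar F ℂ} (hψ : ψ.IsPrimitive) (S : Set F) :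
    energy (cayley S) = ∑ c, ‖charSum ψ S c‖ := by
  rw [energy, spectrum_cayley hψ, Multiset.map_map]
  rfl

/-- A nontrivial character sums to zero over F, which is partitioned into S, {0} and the connection
set of the complement. -/
theorem charSum_compl {ψ : AddChar F ℂ} (hψ : ψ.IsPrimitive) {S : Set F} (h0 : (0 : F) ∉ S)
    {c : F} (hc : c ≠ 0) : charSum ψ {x | x ≠ 0 ∧ x ∉ S} c = -1 - charSum ψ S c := by
  classical
  have h := AddChar.sum_mulShift c hψ
  rw [if_neg hc, ← Finset.sum_filter_add_sum_filter_not _ (· ∈ S),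
    ← Finset.sum_filter_add_sum_filter_not (Finset.univ.filter (· ∉ S)) (· = 0)] at h
  have h1 : (Finset.univ.filter fun x : F => x ∉ S).filter (· = 0) = {0} := by
    ext x; simp; rintro rfl; exact h0
  have h2 : (Finset.univ.filter fun x : F => x ∉ S).filter (¬ · = 0)
      = Finset.univ.filter (· ∈ {x | x ≠ 0 ∧ x ∉ S}) := by
    ext x; simp; tauto
  rw [h1, h2] at h
  simp only [Finset.sum_singleton, zero_mul, AddChar.map_zero_eq_one] at h
  rw [charSum_eq_sum, charSum_eq_sum]
  simp only [mul_comm c]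
  rw [Nat.cast_zero] at h
  linear_combination h

theorem charSum_zero (ψ : AddChar F ℂ) (S : Set F) : charSum ψ S 0 = S.ncard := by
  classical
  simp [charSum, card_filter_mem]

theorem norm_charSum_le (ψ : AddChar F ℂ) (S : Set F) (c : F) : ‖charSum ψ S c‖ ≤ S.ncard := by
  refine (norm_sum_le _ _).trans ?_
  simp [card_filter_mem]

theorem ncard_compl {S : Set F} (h0 : (0 : F) ∉ S) :
    {x | x ≠ 0 ∧ x ∉ S}.ncard + S.ncard + 1 = Fintype.card F := by
  have h1 : {x | x ≠ 0 ∧ x ∉ S} = (insert 0 S)ᶜ := by ext x; simp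
  have h2 := Set.ncard_add_ncard_compl (insert 0 S)
  rw [Set.ncard_insert_of_notMem h0, Nat.card_eq_fintype_card] at h2
  rw [h1]
  omega

/-- Replacing the middle vertex u of a 2-step walk by -u carries walks of the sum graph to walks of
the Cayley graph with the same ends, so the squared matrices agree. -/
theorem energy_cayleySum {S : Set F} (hS : ∀ s ∈ S, -s ∈ S) :
    energy (cayleySum S) = energy (cayley S) := by
  classical
  refine energy_eq_of_sq_eq ?_
  ext v w
  simp only [mul_apply, adjMatrix_cayley_apply, adjMatrix_cayleySum_apply]
  refine Fintype.sum_equiv (Equiv.neg F) _ _ fun u => ?_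
  have hiff : ∀ x, -x ∈ S ↔ x ∈ S := fun x => ⟨fun h => by simpa using hS _ h, hS x⟩
  have h1 : -u - v ∈ S ↔ v + u ∈ S := by rw [← hiff (v + u)]; ring_nf
  have h2 : w - -u ∈ S ↔ u + w ∈ S := by ring_nf
  simp only [Equiv.neg_apply, h1, h2]

theorem trace_cayley {S : Set F} (h0 : (0 : F) ∉ S) : (adjMatrix (cayley S)).trace = 0 := by
  simp [trace, adjMatrix_cayley_apply, h0]

theorem trace_cayleySum_ne_zero (h2 : (2 : F) ≠ 0) {S : Set F} {s : F} (hs : s ∈ S) :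
    (adjMatrix (cayleySum S)).trace ≠ 0 := by
  classical
  simp only [trace, diag_apply, adjMatrix_cayleySum_apply, Finset.sum_boole]
  rw [Nat.cast_ne_zero, Finset.card_ne_zero]
  have : NeZero (2 : F) := ⟨h2⟩
  exact ⟨s / 2, by simpa [add_halves] using hs⟩

/-- The three graphs built on a symmetric set with integral eigenvalues are as required as soon as
the number of nontrivial nonnegative eigenvalues is the degree. -/
theorem triple_of_ncard_nonneg {ψ : AddChar F ℂ} (hψ : ψ.IsPrimitive) (h2 : (2 : F) ≠ 0)
    {S : Set F} (hne : S.Nonempty) (h0 : (0 : F) ∉ S) (hS : ∀ s ∈ S, -s ∈ S)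
    (hdeg : 2 * S.ncard + 1 < Fintype.card F)
    (η : F → ℤ) (hη : ∀ c ≠ 0, charSum ψ S c = η c)
    (hcount : {c | c ≠ 0 ∧ 0 ≤ η c}.ncard = S.ncard) :
    EquienergeticNonIsospectral (cayley S) (cayleySum S) ∧
    EquienergeticNonIsospectral (cayley S) (compl (cayley S)) ∧
    EquienergeticNonIsospectral (cayleySum S) (compl (cayley S)) := by
  classical
  obtain ⟨s, hs⟩ := hne
  set T : Set F := {x | x ≠ 0 ∧ x ∉ S} with hT
  have hT0 : (0 : F) ∉ T := by simp [hT]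
  have hcompl : compl (cayley S) = cayley T := compl_cayley S
  have hcard : T.ncard + S.ncard + 1 = Fintype.card F := ncard_compl h0
  have hsum : energy (cayley S) = energy (cayleySum S) := (energy_cayleySum hS).symm
  have hen : energy (cayley S) = energy (compl (cayley S)) := by
    rw [hcompl, energy_cayley hψ, energy_cayley hψ,
      ← Finset.add_sum_erase _ _ (Finset.mem_univ (0 : F)),
      ← Finset.add_sum_erase _ (fun c => ‖charSum ψ T c‖) (Finset.mem_univ (0 : F)),
      charSum_zero, charSum_zero, Complex.norm_natCast, Complex.norm_natCast]
    -- Integrality enters here: η < 0 means η ≤ -1, so no value lies strictly between -1 and 0.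
    have hdiff : ∀ c ∈ Finset.univ.erase (0 : F), ‖charSum ψ T c‖
        = ‖charSum ψ S c‖ + ((if 0 ≤ η c then 2 else 0) - 1) := by
      intro c hc
      have hc0 : c ≠ 0 := Finset.ne_of_mem_erase hc
      have e : (-1 - (η c : ℂ)) = ((-1 - η c : ℤ) : ℂ) := by push_cast; ring
      rw [charSum_compl hψ h0 hc0, hη c hc0, e, Complex.norm_intCast, Complex.norm_intCast]
      split_ifs with h
      · have h' : (0 : ℝ) ≤ η c := by exact_mod_cast h
        rw [abs_of_nonneg h', abs_of_nonpos (by push_cast; linarith)]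
        push_cast; ring
      · have h' : (η c : ℝ) ≤ -1 := by exact_mod_cast (by omega : η c ≤ -1)
        rw [abs_of_nonpos (by linarith : (η c : ℝ) ≤ 0), abs_of_nonneg (by push_cast; linarith)]
        push_cast; ring
    rw [Finset.sum_congr rfl hdiff, Finset.sum_add_distrib, Finset.sum_sub_distrib,
      ← Finset.sum_filter, Finset.sum_const, Finset.sum_const, Finset.card_erase_of_mem
      (Finset.mem_univ _), Finset.card_univ]
    have hfil : ((Finset.univ.erase (0 : F)).filter fun c => 0 ≤ η c).card
        = {c | c ≠ 0 ∧ 0 ≤ η c}.ncard := by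
      rw [Set.ncard_eq_toFinset_card']
      congr 1
      ext c; simp
    rw [hfil, hcount, ← hcard]
    simp only [nsmul_eq_mul]
    rw [Nat.add_sub_cancel]
    push_cast
    ring
  have hTr : ∀ Γ₁ Γ₂ : Digraph F, (adjMatrix Γ₁).trace ≠ (adjMatrix Γ₂).trace →
      spectrum Γ₁ ≠ spectrum Γ₂ := by
    intro Γ₁ Γ₂ h heq
    rw [← spectrum_sum_eq_trace, ← spectrum_sum_eq_trace, heq] at h
    exact h rfl
  refine ⟨⟨hsum, hTr _ _ ?_⟩, ⟨hen, ?_⟩, ⟨hsum ▸ hen, hTr _ _ ?_⟩⟩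
  · rw [trace_cayley h0]
    exact (trace_cayleySum_ne_zero h2 hs).symm
  -- The degree of the complement exceeds |S|, which bounds every eigenvalue of the Cayley graph.
  · rw [hcompl, spectrum_cayley hψ, spectrum_cayley hψ]
    intro heq
    have hmem : charSum ψ T 0 ∈ Finset.univ.val.map (charSum ψ T) :=
      Multiset.mem_map_of_mem _ (Finset.mem_univ_val 0)
    rw [← heq, Multiset.mem_map] at hmem
    obtain ⟨c, -, hc⟩ := hmem
    have := norm_charSum_le ψ S c
    rw [hc, charSum_zero, Complex.norm_natCast, Nat.cast_le] at this
    omega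
  · rw [hcompl, trace_cayley hT0]
    exact trace_cayleySum_ne_zero h2 hs

end Cayley

end GPaley

/-! ### Exponential sums of k-th powers and their power sums -/

namespace GPaley

theorem sum_range_mul_of_periodic {M : Type*} [AddCommMonoid M] {f : ℕ → M} {b : ℕ}
    (hf : ∀ j, f (j + b) = f j) (a : ℕ) :
    ∑ j ∈ Finset.range (a * b), f j = a • ∑ j ∈ Finset.range b, f j := by
  have hper : ∀ a j, f (a * b + j) = f j := by
    intro a
    induction a with
    | zero => simp
    | succ a ih => intro j; rw [← ih j, ← hf (a * b + j)]; congr 1; ring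
  induction a with
  | zero => simp
  | succ a ih =>
    rw [Nat.succ_mul, Finset.sum_range_add, ih, succ_nsmul]
    simp only [hper]

section PowerSums

variable {F : Type*} [Field F] [Fintype F] {k n : ℕ} {γ : F}

theorem exists_primitiveRoot_card_sub_one (F : Type*) [Field F] [Fintype F] :
    ∃ γ : F, IsPrimitiveRoot γ (Fintype.card F - 1) := by
  classical
  obtain ⟨g, hg⟩ := IsCyclic.exists_generator (α := Fˣ)
  refine ⟨g, IsPrimitiveRoot.coe_units_iff.mpr ?_⟩
  rw [← Fintype.card_units, ← orderOf_eq_card_of_forall_mem_zpowers hg |>.trans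
    Nat.card_eq_fintype_card]
  exact IsPrimitiveRoot.orderOf g

theorem primitiveRoot_ne_zero (hγ : IsPrimitiveRoot γ (Fintype.card F - 1)) : γ ≠ 0 := by
  have h := Fintype.one_lt_card (α := F)
  exact hγ.ne_zero (by omega)

theorem exists_pow_eq (hγ : IsPrimitiveRoot γ (Fintype.card F - 1)) {x : F} (hx : x ≠ 0) :
    ∃ j < Fintype.card F - 1, γ ^ j = x := by
  have h := Fintype.one_lt_card (α := F)
  have : NeZero (Fintype.card F - 1) := ⟨by omega⟩
  exact hγ.eq_pow_of_pow_eq_one (FiniteField.pow_card_sub_one_eq_one x hx)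

theorem sum_eq_sum_range_pow (hγ : IsPrimitiveRoot γ (Fintype.card F - 1)) {M : Type*}
    [AddCommMonoid M] (f : F → M) :
    ∑ x, f x = f 0 + ∑ j ∈ Finset.range (Fintype.card F - 1), f (γ ^ j) := by
  classical
  have hinj : Set.InjOn (fun j => γ ^ j) (Finset.range (Fintype.card F - 1)) := by
    intro i hi j hj hij
    exact hγ.pow_inj (by simpa using hi) (by simpa using hj) hij
  have huniv : (Finset.univ : Finset F)
      = insert 0 ((Finset.range (Fintype.card F - 1)).image fun j => γ ^ j) := by
    ext x
    rcases eq_or_ne x 0 with rfl | hx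
    · simp
    · obtain ⟨j, hj, rfl⟩ := exists_pow_eq hγ hx
      simp only [Finset.mem_univ, Finset.mem_insert, Finset.mem_image, Finset.mem_range, true_iff]
      exact Or.inr ⟨j, hj, rfl⟩
  rw [huniv, Finset.sum_insert, Finset.sum_image hinj]
  simp only [Finset.mem_image, not_exists, not_and]
  intro j _ h
  exact pow_ne_zero j (primitiveRoot_ne_zero hγ) h

theorem mem_powerSet_iff_dvd (hγ : IsPrimitiveRoot γ (Fintype.card F - 1))
    (hkn : k * n = Fintype.card F - 1) (j : ℕ) : γ ^ j ∈ powerSet k F ↔ k ∣ j := by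
  constructor
  · rintro ⟨x, hx, h⟩
    obtain ⟨i, -, rfl⟩ := exists_pow_eq hγ hx
    rw [← pow_mul] at h
    have hu : IsUnit γ := (primitiveRoot_ne_zero hγ).isUnit
    obtain ⟨g, rfl⟩ := hu
    have h' := pow_eq_pow_iff_modEq.mp (Units.ext (by simpa using h) : g ^ j = g ^ (i * k))
    rw [← (IsPrimitiveRoot.coe_units_iff.mp hγ).eq_orderOf, ← hkn] at h'
    have h'' : j ≡ i * k [MOD k] := h'.of_mul_right n
    exact (h''.dvd_iff dvd_rfl).mpr (dvd_mul_left k i)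
  · rintro ⟨i, rfl⟩
    exact ⟨γ ^ i, pow_ne_zero i (primitiveRoot_ne_zero hγ), by rw [← pow_mul, mul_comm]⟩

open Classical in
theorem sum_powerSet (hγ : IsPrimitiveRoot γ (Fintype.card F - 1))
    (hk : 0 < k) (hkn : k * n = Fintype.card F - 1) {M : Type*} [AddCommMonoid M] (f : F → M) :
    ∑ s with s ∈ powerSet k F, f s = ∑ j ∈ Finset.range n, f (γ ^ (k * j)) := by
  have hinj : Set.InjOn (fun j => γ ^ (k * j)) (Finset.range n) := by
    intro i hi j hj hij
    have hi' : i < n := by simpa using hi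
    have hj' : j < n := by simpa using hj
    refine Nat.eq_of_mul_eq_mul_left hk (hγ.pow_inj ?_ ?_ hij) <;> rw [← hkn] <;> gcongr
  rw [← Finset.sum_image hinj]
  congr 1
  ext x
  simp only [Finset.mem_filter, Finset.mem_univ, true_and, Finset.mem_image, Finset.mem_range]
  constructor
  · intro hx
    have hx0 : x ≠ 0 := by
      obtain ⟨y, hy, rfl⟩ := hx
      exact pow_ne_zero k hy
    obtain ⟨j, hj, rfl⟩ := exists_pow_eq hγ hx0
    obtain ⟨i, rfl⟩ := (mem_powerSet_iff_dvd hγ hkn j).mp hx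
    rw [← hkn] at hj
    exact ⟨i, Nat.lt_of_mul_lt_mul_left hj, rfl⟩
  · rintro ⟨j, -, rfl⟩
    exact (mem_powerSet_iff_dvd hγ hkn _).mpr (dvd_mul_right k j)

theorem ncard_powerSet (hk : 0 < k) (hkn : k * n = Fintype.card F - 1) :
    (powerSet k F).ncard = n := by
  classical
  obtain ⟨γ, hγ⟩ := exists_primitiveRoot_card_sub_one F
  have := sum_powerSet hγ hk hkn (fun _ => 1)
  rw [← card_filter_mem]
  simpa using this

/-- Summation of a function that is constant on the cosets of the `k`-th powers. -/
theorem sum_eq_of_coset_invariant (hγ : IsPrimitiveRoot γ (Fintype.card F - 1))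
    (hkn : k * n = Fintype.card F - 1) {M : Type*} [AddCommMonoid M] {f : F → M}
    (hf : ∀ c, f (c * γ ^ k) = f c) :
    ∑ x, f x = f 0 + n • ∑ i ∈ Finset.range k, f (γ ^ i) := by
  rw [sum_eq_sum_range_pow hγ, ← hkn, mul_comm k n,
    sum_range_mul_of_periodic (f := fun j => f (γ ^ j))]
  intro j
  rw [pow_add, hf]

open Classical in
theorem sum_comp_pow (hk : 0 < k) (hkn : k * n = Fintype.card F - 1) {M : Type*}
    [AddCommMonoid M] (f : F → M) :
    ∑ x : F, f (x ^ k) = f 0 + k • ∑ s with s ∈ powerSet k F, f s := by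
  obtain ⟨γ, hγ⟩ := exists_primitiveRoot_card_sub_one F
  rw [sum_eq_sum_range_pow hγ, sum_powerSet hγ hk hkn, zero_pow hk.ne', ← hkn]
  simp only [← pow_mul, mul_comm _ k]
  rw [sum_range_mul_of_periodic (f := fun j => f (γ ^ (k * j)))]
  intro j
  rw [mul_add, pow_add, hkn, hγ.pow_eq_one, mul_one]

/-- The number of `k`-th roots of `u`. -/
noncomputable def rootCount (k : ℕ) (u : F) : ℕ := {y : F | y ^ k = u}.ncard

open Classical in
theorem rootCount_eq_sum (k : ℕ) (u : F) : rootCount k u = ∑ y : F, if y ^ k = u then 1 else 0 := by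
  rw [rootCount, ← card_filter_mem]
  simp

open Classical in
theorem rootCount_eq (hk : 0 < k) (hkn : k * n = Fintype.card F - 1) (u : F) :
    rootCount k u = (if u = 0 then 1 else 0) + if u ∈ powerSet k F then k else 0 := by
  rw [rootCount_eq_sum, sum_comp_pow hk hkn (fun v => if v = u then 1 else 0)]
  simp [eq_comm]

theorem zero_notMem_powerSet (k : ℕ) (F : Type*) [Field F] : (0 : F) ∉ powerSet k F := by
  rintro ⟨x, hx, hx0⟩
  exact pow_ne_zero k hx hx0.symm

/-- For u ≠ 0, u^n is a k-th root of unity, equal to 1 exactly when u is a k-th power, so the right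
side is a geometric sum equal to k or 0. For u = 0 only the term i = 0 survives. -/
theorem rootCount_cast (hk : 0 < k) (hkn : k * n = Fintype.card F - 1) (u : F) :
    (rootCount k u : F) = ∑ i ∈ Finset.range k, u ^ (i * n) := by
  classical
  have hq := Fintype.one_lt_card (α := F)
  have hn : n ≠ 0 := by rintro rfl; omega
  obtain ⟨γ, hγ⟩ := exists_primitiveRoot_card_sub_one F
  rw [rootCount_eq hk hkn]
  rcases eq_or_ne u 0 with rfl | hu
  · obtain ⟨k, rfl⟩ := Nat.exists_eq_succ_of_ne_zero hk.ne'
    rw [Finset.sum_range_succ']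
    simp [zero_notMem_powerSet, hn]
  · obtain ⟨j, -, rfl⟩ := exists_pow_eq hγ hu
    simp only [hu, if_false, zero_add, mem_powerSet_iff_dvd hγ hkn, mul_comm _ n]
    simp only [pow_mul _ n]
    split_ifs with h
    · obtain ⟨i, rfl⟩ := h
      have : (γ ^ (k * i)) ^ n = 1 := by
        rw [← pow_mul, mul_right_comm, hkn, pow_mul, hγ.pow_eq_one, one_pow]
      simp [this]
    · have h1 : (γ ^ j) ^ n ≠ 1 := by
        rw [← pow_mul]
        intro h1
        have := hγ.dvd_of_pow_eq_one _ h1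
        rw [← hkn] at this
        exact h (Nat.dvd_of_mul_dvd_mul_right (Nat.pos_of_ne_zero hn) this)
      rw [geom_sum_eq h1, ← pow_mul, ← pow_mul, mul_comm n k, hkn, mul_comm j, pow_mul,
        hγ.pow_eq_one, one_pow]
      simp

/-- The number of solutions of `x ^ k + y ^ k = 1`. -/
noncomputable def fermatCount (k : ℕ) (F : Type*) [Field F] [Fintype F] : ℕ :=
  ∑ x : F, rootCount k (1 - x ^ k)

/-- The exponential sum of the `k`-th powers. -/
noncomputable def powerSum (ψ : AddChar F ℂ) (k : ℕ) (c : F) : ℂ := ∑ x : F, ψ (c * x ^ k)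

theorem powerSum_eq (hk : 0 < k) (hkn : k * n = Fintype.card F - 1) (ψ : AddChar F ℂ) (c : F) :
    powerSum ψ k c = 1 + k * charSum ψ (powerSet k F) c := by
  rw [powerSum, sum_comp_pow hk hkn (fun v => ψ (c * v)), charSum]
  simp

theorem powerSum_zero (ψ : AddChar F ℂ) (k : ℕ) : powerSum ψ k 0 = Fintype.card F := by
  simp [powerSum]

theorem powerSum_mul_pow (ψ : AddChar F ℂ) (k : ℕ) (c : F) {y : F} (hy : y ≠ 0) :
    powerSum ψ k (c * y ^ k) = powerSum ψ k c := by
  rw [powerSum, powerSum]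
  refine Fintype.sum_equiv (Equiv.mulLeft₀ y hy) _ _ fun x => ?_
  simp [mul_pow, mul_assoc]

theorem sum_powerSum {ψ : AddChar F ℂ} (hψ : ψ.IsPrimitive) (hk : 0 < k) :
    ∑ c, powerSum ψ k c = Fintype.card F := by
  classical
  simp only [powerSum]
  rw [Finset.sum_comm]
  simp only [AddChar.sum_mulShift _ hψ, pow_eq_zero_iff hk.ne']
  simp

/-- By orthogonality, the second moment counts the solutions of x^k + y^k = 0; the third moment
below counts those of x^k + y^k + z^k = 0. -/
theorem sum_powerSum_sq {ψ : AddChar F ℂ} (hψ : ψ.IsPrimitive) (k : ℕ) :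
    ∑ c, powerSum ψ k c ^ 2 = Fintype.card F * (∑ x : F, rootCount k (-x ^ k) : ℕ) := by
  classical
  have h : ∀ c, powerSum ψ k c ^ 2 = ∑ x : F, ∑ y : F, ψ (c * (x ^ k + y ^ k)) := by
    intro c
    simp only [pow_two, powerSum, Finset.sum_mul_sum, mul_add, AddChar.map_add_eq_mul]
  simp only [h]
  rw [Finset.sum_comm, Nat.cast_sum, Finset.mul_sum]
  refine Finset.sum_congr rfl fun x _ => ?_
  rw [Finset.sum_comm, rootCount_eq_sum, Nat.cast_sum, Finset.mul_sum]
  refine Finset.sum_congr rfl fun y _ => ?_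
  rw [AddChar.sum_mulShift _ hψ, add_comm, add_eq_zero_iff_eq_neg]
  split_ifs <;> simp

theorem sum_powerSum_cube {ψ : AddChar F ℂ} (hψ : ψ.IsPrimitive) (k : ℕ) :
    ∑ c, powerSum ψ k c ^ 3
      = Fintype.card F * (∑ z : F, ∑ x : F, rootCount k (-z ^ k - x ^ k) : ℕ) := by
  classical
  have h : ∀ c, powerSum ψ k c ^ 3
      = ∑ z : F, ∑ x : F, ∑ y : F, ψ (c * (y ^ k - (-z ^ k - x ^ k))) := by
    intro c
    have : ∀ z x y : F, ψ (c * (y ^ k - (-z ^ k - x ^ k)))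
        = ψ (c * z ^ k) * (ψ (c * x ^ k) * ψ (c * y ^ k)) := by
      intro z x y
      rw [← AddChar.map_add_eq_mul, ← AddChar.map_add_eq_mul]
      congr 1; ring
    simp only [this, ← Finset.mul_sum, ← Finset.sum_mul, powerSum]
    ring
  simp only [h]
  rw [Finset.sum_comm, Nat.cast_sum, Finset.mul_sum]
  refine Finset.sum_congr rfl fun z _ => ?_
  rw [Finset.sum_comm, Nat.cast_sum, Finset.mul_sum]
  refine Finset.sum_congr rfl fun x _ => ?_
  rw [Finset.sum_comm, rootCount_eq_sum, Nat.cast_sum, Finset.mul_sum]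
  refine Finset.sum_congr rfl fun y _ => ?_
  rw [AddChar.sum_mulShift _ hψ, sub_eq_zero]
  split_ifs <;> simp

theorem sum_rootCount_neg (hk : 0 < k) (hkn : k * n = Fintype.card F - 1) {ζ : F}
    (hζ : ζ ^ k = -1) : ∑ x : F, rootCount k (-x ^ k) = 1 + (Fintype.card F - 1) * k := by
  classical
  have h : ∀ x ∈ Finset.univ.erase (0 : F), rootCount k (-x ^ k) = k := by
    intro x hx
    have hx0 : x ≠ 0 := Finset.ne_of_mem_erase hx
    have hζ0 : ζ ≠ 0 := by rintro rfl; simp [zero_pow hk.ne'] at hζ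
    rw [rootCount_eq hk hkn, if_neg (by simp [hx0]), if_pos ⟨ζ * x, mul_ne_zero hζ0 hx0, by
      rw [mul_pow, hζ]; ring⟩, zero_add]
  rw [← Finset.add_sum_erase _ _ (Finset.mem_univ (0 : F)), Finset.sum_congr rfl h,
    rootCount_eq hk hkn]
  simp [zero_notMem_powerSet, hk.ne', Finset.card_erase_of_mem]

/-- For z ≠ 0, -z^k = (ζz)^k, and dividing by it turns the equation into x^k + y^k = 1. The slice z
= 0 is `sum_rootCount_neg`. -/
theorem sum_sum_rootCount_neg (hk : 0 < k) (hkn : k * n = Fintype.card F - 1) {ζ : F}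
    (hζ : ζ ^ k = -1) : ∑ z : F, ∑ x : F, rootCount k (-z ^ k - x ^ k)
      = 1 + (Fintype.card F - 1) * k + (Fintype.card F - 1) * fermatCount k F := by
  classical
  have hζ0 : ζ ≠ 0 := by rintro rfl; simp [zero_pow hk.ne'] at hζ
  have hscale : ∀ (w u : F), w ≠ 0 → rootCount k (w ^ k * u) = rootCount k u := by
    intro w u hw
    rw [rootCount_eq_sum, rootCount_eq_sum]
    refine Fintype.sum_equiv (Equiv.mulLeft₀ w⁻¹ (inv_ne_zero hw)) _ _ fun y => ?_
    congr 1
    simp only [Equiv.mulLeft₀_apply, mul_pow, inv_pow, eq_iff_iff]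
    rw [inv_mul_eq_iff_eq_mul₀ (pow_ne_zero k hw)]
  have h : ∀ z ∈ Finset.univ.erase (0 : F),
      ∑ x : F, rootCount k (-z ^ k - x ^ k) = fermatCount k F := by
    intro z hz
    have hz0 : z ≠ 0 := Finset.ne_of_mem_erase hz
    have hw : ζ * z ≠ 0 := mul_ne_zero hζ0 hz0
    rw [fermatCount]
    refine Fintype.sum_equiv (Equiv.mulLeft₀ (ζ * z)⁻¹ (inv_ne_zero hw)) _ _ fun x => ?_
    rw [← hscale (ζ * z) (1 - _) hw]
    congr 1
    simp only [Equiv.mulLeft₀_apply]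
    have : x = (ζ * z) * ((ζ * z)⁻¹ * x) := (mul_inv_cancel_left₀ hw x).symm
    rw [mul_sub, ← mul_pow, ← this, mul_pow, hζ]
    ring
  rw [← Finset.add_sum_erase _ _ (Finset.mem_univ (0 : F)), Finset.sum_congr rfl h]
  have h0 : ∑ x : F, rootCount k (-0 ^ k - x ^ k) = 1 + (Fintype.card F - 1) * k := by
    rw [← sum_rootCount_neg hk hkn hζ]
    simp [zero_pow hk.ne']
  rw [h0]
  simp [Finset.card_erase_of_mem]

variable {ψ : AddChar F ℂ}

/-- The first three power sums of the values of `powerSum` on coset representatives. -/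
theorem sum_range_powerSum (hψ : ψ.IsPrimitive) (hγ : IsPrimitiveRoot γ (Fintype.card F - 1))
    (hk : 0 < k) (hkn : k * n = Fintype.card F - 1) {ζ : F} (hζ : ζ ^ k = -1) :
    ∑ i ∈ Finset.range k, powerSum ψ k (γ ^ i) = 0 ∧
    ∑ i ∈ Finset.range k, powerSum ψ k (γ ^ i) ^ 2 = k * (k - 1) * Fintype.card F ∧
    ∑ i ∈ Finset.range k, powerSum ψ k (γ ^ i) ^ 3
      = k * Fintype.card F * (fermatCount k F - Fintype.card F - 1 + k) := by
  have hγ0 := primitiveRoot_ne_zero hγ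
  have hinv : ∀ c, powerSum ψ k (c * γ ^ k) = powerSum ψ k c :=
    fun c => powerSum_mul_pow ψ k c hγ0
  have hq := Fintype.one_lt_card (α := F)
  have hn : (n : ℂ) ≠ 0 := by
    rw [Nat.cast_ne_zero]; rintro rfl; omega
  have hknC : (k : ℂ) * n = Fintype.card F - 1 := by
    rw [← Nat.cast_mul, hkn, Nat.cast_sub hq.le, Nat.cast_one]
  have h1 := sum_powerSum hψ hk
  have h2 := sum_powerSum_sq hψ k
  have h3 := sum_powerSum_cube hψ k
  rw [sum_rootCount_neg hk hkn hζ] at h2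
  rw [sum_sum_rootCount_neg hk hkn hζ] at h3
  rw [sum_eq_of_coset_invariant hγ hkn hinv, powerSum_zero] at h1
  rw [sum_eq_of_coset_invariant hγ hkn (f := fun c => powerSum ψ k c ^ 2)
    (fun c => by simp only [hinv]), powerSum_zero] at h2
  rw [sum_eq_of_coset_invariant hγ hkn (f := fun c => powerSum ψ k c ^ 3)
    (fun c => by simp only [hinv]), powerSum_zero] at h3
  rw [← hkn] at h2 h3
  -- Each moment is the term at c = 0, a power of q, plus n times the sum over coset
  -- representatives; the factor n is cancelled.
  simp only [nsmul_eq_mul, Nat.cast_add, Nat.cast_mul, Nat.cast_one] at h1 h2 h3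
  refine ⟨?_, ?_, ?_⟩ <;> refine mul_left_cancel₀ hn ?_
  · linear_combination h1
  · linear_combination h2 + Fintype.card F * hknC
  · linear_combination h3 + Fintype.card F * (1 + Fintype.card F) * hknC

end PowerSums

end GPaley

/-! ### Integrality of the Gaussian periods -/

namespace GPaley

section Integrality

variable {F : Type*} [Field F] [Fintype F] {k n p : ℕ}

theorem isIntegral_addChar {G : Type*} [AddGroup G] [Finite G] (ψ : AddChar G ℂ) (x : G) :
    IsIntegral ℤ (ψ x) := by
  refine IsIntegral.of_pow (n := Nat.card G) Nat.card_pos ?_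
  rw [← AddChar.map_nsmul_eq_pow, card_nsmul_eq_zero', AddChar.map_zero_eq_one]
  exact isIntegral_one

/-- If the nonzero elements of the prime field are `k`-th powers, the character sums of the set of
`k`-th powers are integers. -/
theorem exists_int_charSum [CharP F p] (hp : p.Prime) (hk : 0 < k)
    (hkn : k * n = Fintype.card F - 1)
    (hprime : ∀ j : ℕ, (j : F) ≠ 0 → (j : F) ∈ powerSet k F) (ψ : AddChar F ℂ) (c : F) :
    ∃ e : ℤ, charSum ψ (powerSet k F) c = e := by
  classical
  have hint : IsIntegral ℤ (charSum ψ (powerSet k F) c) :=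
    IsIntegral.sum _ fun s _ => isIntegral_addChar ψ _
  have hconst : ∀ j : ℕ, j + 1 ∈ Finset.Icc 1 (p - 1) →
      powerSum ψ k (((j + 1 : ℕ) : F) * c) = powerSum ψ k c := by
    intro j hj
    rw [Finset.mem_Icc] at hj
    have hj0 : ((j + 1 : ℕ) : F) ≠ 0 := by
      rw [Ne, CharP.cast_eq_zero_iff F p]
      intro h
      have := Nat.le_of_dvd (by omega) h
      have := hp.two_le
      omega
    obtain ⟨y, hy, h⟩ := hprime _ hj0
    rw [h, mul_comm, powerSum_mul_pow ψ k c hy]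
  have hone : ∀ z : ℂ, z ^ p = 1 → ∑ j ∈ Finset.range p, z ^ j = if z = 1 then (p : ℂ) else 0 := by
    intro z hz
    split_ifs with h
    · simp [h]
    · rw [geom_sum_eq h, hz]; simp
  -- The sum over prime-field multiples of c is computed twice: by invariance under k-th powers, and
  -- by summing p-th roots of unity. This makes the period rational, and it is an algebraic integer.
  have hsum : ∑ j ∈ Finset.range p, powerSum ψ k ((j : F) * c)
      = Fintype.card F + (p - 1 : ℕ) * powerSum ψ k c := by
    obtain ⟨r, hr⟩ : ∃ r, p = r + 1 := ⟨p - 1, by have := hp.two_le; omega⟩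
    rw [hr, Finset.sum_range_succ', Finset.sum_congr rfl fun j hj => hconst j (by
      rw [Finset.mem_Icc]; have := Finset.mem_range.mp hj; omega)]
    simp [powerSum_zero, add_comm]
  have hsum' : ∑ j ∈ Finset.range p, powerSum ψ k ((j : F) * c)
      = p * ((Finset.univ.filter fun x : F => ψ (c * x ^ k) = 1).card : ℕ) := by
    simp only [powerSum]
    rw [Finset.sum_comm]
    have : ∀ x : F, ∑ j ∈ Finset.range p, ψ ((j : F) * c * x ^ k)
        = if ψ (c * x ^ k) = 1 then (p : ℂ) else 0 := by
      intro x
      rw [← hone]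
      · refine Finset.sum_congr rfl fun j _ => ?_
        rw [mul_assoc, ← nsmul_eq_mul, AddChar.map_nsmul_eq_pow]
      · rw [← AddChar.map_nsmul_eq_pow, nsmul_eq_mul, CharP.cast_eq_zero, zero_mul,
          AddChar.map_zero_eq_one]
    simp only [this]
    rw [← Finset.sum_filter, Finset.sum_const, nsmul_eq_mul, mul_comm]
  set A := (Finset.univ.filter fun x : F => ψ (c * x ^ k) = 1).card
  rw [hsum, powerSum_eq hk hkn] at hsum'
  have hp1 : ((p - 1 : ℕ) : ℂ) ≠ 0 := by
    rw [Nat.cast_ne_zero]; have := hp.two_le; omega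
  have hkC : (k : ℂ) ≠ 0 := by rw [Nat.cast_ne_zero]; exact hk.ne'
  have hrat : charSum ψ (powerSet k F) c
      = algebraMap ℚ ℂ (((p * A - Fintype.card F : ℚ) / (p - 1 : ℕ) - 1) / k) := by
    rw [eq_ratCast]
    push_cast
    field_simp
    linear_combination hsum'
  rw [hrat, isIntegral_algebraMap_iff (algebraMap ℚ ℂ).injective,
    IsIntegrallyClosed.isIntegral_iff] at hint
  obtain ⟨e, he⟩ := hint
  refine ⟨e, ?_⟩
  rw [hrat, ← he]
  simp

end Integrality

/-! ### The Fermat count modulo p -/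

section Residues

variable {F : Type*} [Field F] [Fintype F] {k n p : ℕ}

open Classical in
theorem sum_pow_eq (e : ℕ) :
    ∑ x : F, x ^ e = if e ≠ 0 ∧ Fintype.card F - 1 ∣ e then -1 else 0 := by
  have hq := Fintype.one_lt_card (α := F)
  rcases eq_or_ne e 0 with rfl | he
  · simp
  obtain ⟨γ, hγ⟩ := exists_primitiveRoot_card_sub_one F
  rw [sum_eq_sum_range_pow hγ, zero_pow he, zero_add]
  simp only [← pow_mul, mul_comm _ e]
  simp only [pow_mul]
  by_cases h : Fintype.card F - 1 ∣ e
  · simp [(hγ.pow_eq_one_iff_dvd e).mpr h, he, h, Nat.cast_sub hq.le]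
  · have h1 : γ ^ e ≠ 1 := fun h1 => h (hγ.dvd_of_pow_eq_one _ h1)
    rw [geom_sum_eq h1, if_neg (by tauto), ← pow_mul, mul_comm, pow_mul, hγ.pow_eq_one]
    simp

theorem sum_range_multiples {M : Type*} [AddCommMonoid M] (hn : 0 < n) (i : ℕ) (g : ℕ → M) :
    (∑ j ∈ Finset.range (i * n + 1), if j ≠ 0 ∧ n ∣ j then g j else 0)
      = ∑ l ∈ Finset.range i, g ((l + 1) * n) := by
  rw [← Finset.sum_filter]
  have hinj : Set.InjOn (fun l => (l + 1) * n) (Finset.range i) := by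
    intro a _ b _ h
    have := Nat.eq_of_mul_eq_mul_right hn h
    omega
  rw [← Finset.sum_image hinj]
  congr 1
  ext j
  simp only [Finset.mem_filter, Finset.mem_range, Finset.mem_image]
  constructor
  · rintro ⟨hj, hj0, l, rfl⟩
    obtain ⟨l, rfl⟩ : ∃ r, l = r + 1 :=
      ⟨l - 1, by rcases Nat.eq_zero_or_pos l with rfl | h <;> simp_all; omega⟩
    have : n * (l + 1) ≤ n * i := by rw [mul_comm n i]; omega
    have := Nat.le_of_mul_le_mul_left this hn
    exact ⟨l, by omega, mul_comm _ _⟩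
  · rintro ⟨l, hl, rfl⟩
    have : (l + 1) * n ≤ i * n := Nat.mul_le_mul_right n (by omega)
    exact ⟨by omega, by positivity, dvd_mul_left _ _⟩

/-- The number of solutions of `x ^ k + y ^ k = 1`, modulo the characteristic. -/
theorem fermatCount_cast (hk : 0 < k) (hkn : k * n = Fintype.card F - 1)
    (hneg : (-1 : F) ^ n = 1) :
    (fermatCount k F : F)
      = -∑ i ∈ Finset.range k, ∑ l ∈ Finset.range i, ((i * n).choose ((l + 1) * n) : F) := by
  classical
  have hq := Fintype.one_lt_card (α := F)
  have hn : 0 < n := by rcases Nat.eq_zero_or_pos n with rfl | h <;> omega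
  rw [fermatCount, Nat.cast_sum]
  simp only [rootCount_cast hk hkn]
  rw [Finset.sum_comm, ← Finset.sum_neg_distrib]
  refine Finset.sum_congr rfl fun i _ => ?_
  have hexp : ∀ x : F, (1 - x ^ k) ^ (i * n)
      = ∑ j ∈ Finset.range (i * n + 1), (-1) ^ j * ((i * n).choose j : F) * x ^ (k * j) := by
    intro x
    rw [sub_eq_add_neg, add_comm, add_pow]
    refine Finset.sum_congr rfl fun j _ => ?_
    rw [one_pow, neg_pow, ← pow_mul]
    ring
  have hdvd : ∀ j, (k * j ≠ 0 ∧ Fintype.card F - 1 ∣ k * j) ↔ (j ≠ 0 ∧ n ∣ j) := by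
    intro j
    rw [← hkn, Nat.mul_dvd_mul_iff_left hk]
    simp [hk.ne']
  simp only [hexp]
  rw [Finset.sum_comm]
  simp only [← Finset.mul_sum, sum_pow_eq, hdvd, mul_ite, mul_zero]
  rw [sum_range_multiples hn, ← Finset.sum_neg_distrib]
  refine Finset.sum_congr rfl fun l _ => ?_
  rw [mul_comm (l + 1) n, pow_mul, hneg]
  ring

/-- Lucas' theorem for numbers all of whose base `p` digits are equal. -/
theorem choose_mul_geomSum_modEq (hp : p.Prime) {a b : ℕ} (ha : a < p) (hb : b < p) (m : ℕ) :
    (a * ∑ i ∈ Finset.range m, p ^ i).choose (b * ∑ i ∈ Finset.range m, p ^ i)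
      ≡ a.choose b ^ m [MOD p] := by
  have : Fact p.Prime := ⟨hp⟩
  induction m with
  | zero => simpa using Nat.ModEq.refl 1
  | succ m ih =>
    have h : ∀ c < p, c * ∑ i ∈ Finset.range (m + 1), p ^ i
        = p * (c * ∑ i ∈ Finset.range m, p ^ i) + c := by
      intro c _
      rw [geom_sum_succ]; ring
    refine Choose.choose_modEq_choose_mod_mul_choose_div_nat.trans ?_
    rw [h a ha, h b hb, Nat.mul_add_mod, Nat.mul_add_mod, Nat.mod_eq_of_lt ha, Nat.mod_eq_of_lt hb,
      Nat.mul_add_div hp.pos, Nat.mul_add_div hp.pos, Nat.div_eq_of_lt ha, Nat.div_eq_of_lt hb,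
      add_zero, add_zero, pow_succ']
    exact ih.mul_left _

theorem cast_choose_mul_geomSum {F : Type*} [Field F] [CharP F p] (hp : p.Prime) {a b : ℕ} (ha : a < p) (hb : b < p)
    (m : ℕ) :
    ((a * ∑ i ∈ Finset.range m, p ^ i).choose (b * ∑ i ∈ Finset.range m, p ^ i) : F)
      = (a.choose b : F) ^ m := by
  rw [← Nat.cast_pow, CharP.natCast_eq_natCast F p]
  exact choose_mul_geomSum_modEq hp ha hb m

theorem cast_factorial_ne_zero {F : Type*} [Field F] [CharP F p] (hp : p.Prime) {a : ℕ} (ha : a < p) :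
    (a.factorial : F) ≠ 0 := by
  rw [Ne, CharP.cast_eq_zero_iff F p, hp.dvd_factorial]
  omega

theorem cast_choose_ne_zero {F : Type*} [Field F] [CharP F p] (hp : p.Prime) {a b : ℕ} (ha : a < p) (hba : b ≤ a) :
    (a.choose b : F) ≠ 0 := by
  intro h
  have := Nat.choose_mul_factorial_mul_factorial hba
  apply cast_factorial_ne_zero (F := F) hp ha
  rw [← this]
  simp [h]

/-- `3 n ≡ - (n + 1)` modulo `p = 4 n + 1`, on the level of binomial coefficients. -/
theorem cast_choose_three_mul {F : Type*} [Field F] [CharP F p] (hp : p.Prime) {a : ℕ} (ha : 4 * a + 1 = p) :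
    ((3 * a).choose a : F) = (-1) ^ a * ((2 * a).choose a : F) := by
  refine mul_left_cancel₀ (cast_factorial_ne_zero (F := F) hp (a := a) (by omega)) ?_
  have h1 := Nat.descFactorial_eq_factorial_mul_choose (3 * a) a
  have h2 := Nat.ascFactorial_eq_factorial_mul_choose a a
  rw [← two_mul] at h2
  have hp0 : (4 * a + 1 : F) = 0 := by
    have := CharP.cast_eq_zero F p
    rw [← ha] at this
    exact_mod_cast this
  calc (a.factorial : F) * ((3 * a).choose a : F) = ((3 * a).descFactorial a : ℕ) := by
        rw [h1]; push_cast; ring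
    _ = ∏ i ∈ Finset.range a, (-1) * ((a + 1 + i : ℕ) : F) := by
        rw [Nat.descFactorial_eq_prod_range, Nat.cast_prod]
        refine Finset.prod_congr rfl fun i hi => ?_
        have := Finset.mem_range.mp hi
        rw [Nat.cast_sub (by omega)]
        push_cast
        -- Since 4a + 1 = 0 in F, 3a - i = -(a + 1 + i).
        linear_combination hp0
    _ = (-1) ^ a * ((a + 1).ascFactorial a : ℕ) := by
        rw [Finset.prod_mul_distrib, Nat.ascFactorial_eq_prod_range, Nat.cast_prod]
        simp
    _ = _ := by
        rw [h2]; push_cast; ring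

end Residues

end GPaley

/-! ### Uniqueness of representations and sign patterns -/

namespace GPaley

section Arithmetic

/-- A prime power times a small constant is represented by `x ^ 2 + D * y ^ 2` with `x` prime to `p`
in essentially one way. -/
theorem sq_eq_sq_of_two_representations {p : ℕ} (hp : p.Prime) (hp2 : p ≠ 2) {r : ℕ} (hr : r ≠ 0)
    {C D x y z w : ℤ} (hC : C ≠ 0) (hD : ∀ X Y : ℤ, C ^ 2 = X ^ 2 + D * Y ^ 2 → Y = 0)
    (hxy : C * (p : ℤ) ^ r = x ^ 2 + D * y ^ 2) (hzw : C * (p : ℤ) ^ r = z ^ 2 + D * w ^ 2)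
    (hx : ¬ (p : ℤ) ∣ x) (hz : ¬ (p : ℤ) ∣ z) : x ^ 2 = z ^ 2 ∧ y ^ 2 = w ^ 2 := by
  have hpZ : Prime (p : ℤ) := Nat.prime_iff_prime_int.mp hp
  have hM : (p : ℤ) ^ r ≠ 0 := pow_ne_zero r hpZ.ne_zero
  -- Brahmagupta's identity, divided by p^(2r), gives C² = X² + DY², so `hD` kills Y. The variable y
  -- is left free so that -y can be used too.
  have key : ∀ y : ℤ, C * (p : ℤ) ^ r = x ^ 2 + D * y ^ 2 → (p : ℤ) ^ r ∣ x * w - z * y →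
      x ^ 2 = z ^ 2 ∧ y ^ 2 = w ^ 2 := by
    rintro y hxy ⟨Y, hY⟩
    have h1 : (C * (p : ℤ) ^ r) ^ 2 = (x * z + D * y * w) ^ 2 + D * (x * w - z * y) ^ 2 := by
      calc (C * (p : ℤ) ^ r) ^ 2 = (C * (p : ℤ) ^ r) * (C * (p : ℤ) ^ r) := pow_two _
        _ = (x ^ 2 + D * y ^ 2) * (z ^ 2 + D * w ^ 2) := by
            conv_lhs => rw [hxy, ← hxy, hzw]
            rw [← hzw, hxy]
        _ = _ := by ring
    have h2 : (p : ℤ) ^ r ∣ x * z + D * y * w := by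
      rw [← Int.pow_dvd_pow_iff two_ne_zero]
      refine ⟨C ^ 2 - D * Y ^ 2, ?_⟩
      rw [hY] at h1
      linear_combination -h1
    obtain ⟨X, hX⟩ := h2
    have hY0 : Y = 0 := by
      refine hD X Y (mul_left_cancel₀ (pow_ne_zero 2 hM) ?_)
      rw [hX, hY] at h1
      linear_combination h1
    rw [hY0, mul_zero] at hY
    have h3 : C * (p : ℤ) ^ r * (w ^ 2 - y ^ 2) = 0 := by
      linear_combination (x * w + z * y) * hY + w ^ 2 * hxy - y ^ 2 * hzw
    have h4 : w ^ 2 - y ^ 2 = 0 := (mul_eq_zero.mp h3).resolve_left (mul_ne_zero hC hM)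
    exact ⟨by linear_combination hzw - hxy + D * h4, by linear_combination -h4⟩
  have hprod : (x * w - z * y) * (x * w + z * y) = (p : ℤ) ^ r * (C * (w ^ 2 - y ^ 2)) := by
    linear_combination -w ^ 2 * hxy + y ^ 2 * hzw
  have hcop : ∀ t : ℤ, ¬ (p : ℤ) ∣ t → IsCoprime ((p : ℤ) ^ r) t := fun t ht =>
    (hpZ.coprime_iff_not_dvd.mpr ht).pow_left
  -- The prime p cannot divide both factors of `hprod`, so p^r divides one of them entirely.
  by_cases h1 : (p : ℤ) ∣ x * w + z * y
  · by_cases h2 : (p : ℤ) ∣ x * w - z * y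
    · exfalso
      have h3 : (p : ℤ) ∣ 2 * (x * w) := by
        have := dvd_add h1 h2
        rwa [show x * w + z * y + (x * w - z * y) = 2 * (x * w) by ring] at this
      have hw : (p : ℤ) ∣ w := by
        rcases hpZ.dvd_or_dvd h3 with h | h
        · exact absurd ((Nat.prime_dvd_prime_iff_eq hp Nat.prime_two).mp (by exact_mod_cast h)) hp2
        · exact (hpZ.dvd_or_dvd h).resolve_left hx
      refine hz (hpZ.dvd_of_dvd_pow (n := 2) ?_)
      have : z ^ 2 = C * (p : ℤ) ^ r - D * w ^ 2 := by linear_combination -hzw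
      rw [this]
      exact dvd_sub (Dvd.dvd.mul_left (dvd_pow_self _ hr) _)
        (Dvd.dvd.mul_left (dvd_pow hw two_ne_zero) _)
    · have h3 : (p : ℤ) ^ r ∣ x * w - z * -y := by
        have := (hcop _ h2).dvd_of_dvd_mul_left (Dvd.intro _ hprod.symm)
        rwa [mul_neg, sub_neg_eq_add]
      obtain ⟨e1, e2⟩ := key (-y) (by rw [neg_sq]; exact hxy) h3
      exact ⟨e1, by rwa [neg_sq] at e2⟩
  · exact key y hxy ((hcop _ h1).dvd_of_dvd_mul_right (Dvd.intro _ hprod.symm))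

/-- The sign pattern of the cubic exponential sums. -/
theorem cubic_prod_pos {p s : ℕ} (hp : p.Prime) (hp3 : p % 3 = 1) (hp2 : p ≠ 2) (hs : s ≠ 0)
    {g₀ g₁ g₂ T a b : ℤ} (h₀ : g₀ % 3 = 1) (h₁ : g₁ % 3 = 1) (h₂ : g₂ % 3 = 1)
    (hsum : g₀ + g₁ + g₂ = 0) (hsq : g₀ ^ 2 + g₁ ^ 2 + g₂ ^ 2 = 6 * ((p : ℤ) ^ s) ^ 3)
    (hcube : g₀ ^ 3 + g₁ ^ 3 + g₂ ^ 3 = 3 * ((p : ℤ) ^ s) ^ 3 * T) (hT : ¬ (p : ℤ) ∣ T)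
    (hab : 4 * (p : ℤ) ^ s = a ^ 2 + 27 * b ^ 2) (ha : a % 3 = 1) (hpa : ¬ (p : ℤ) ∣ a)
    (hsign : a > 9 * |b| ∨ (a < 0 ∧ -a < 9 * |b|)) : 0 < g₀ * g₁ * g₂ := by
  have hpZ : Prime (p : ℤ) := Nat.prime_iff_prime_int.mp hp
  have hQ3 : (p : ℤ) ^ s % 3 = 1 := by
    have : (p : ℤ) ≡ 1 [ZMOD 3] := by
      unfold Int.ModEq; omega
    have := this.pow s
    rwa [one_pow] at this
  have hQpos : 0 < (p : ℤ) ^ s := pow_pos (by exact_mod_cast hp.pos) s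
  set Q : ℤ := (p : ℤ) ^ s with hQ
  have hQ0 : Q ^ 3 ≠ 0 := pow_ne_zero 3 hQpos.ne'
  -- The values are divisible by `Q`, with quotients prime to `p`.
  have hroot : ∀ g : ℤ, g ^ 3 = 3 * Q ^ 3 * g + Q ^ 3 * T → g % 3 = 1 →
      ∃ c, g = Q * c ∧ ¬ (p : ℤ) ∣ c ∧ c % 3 = 1 := by
    intro g hg hg3
    have hdvd : Q ∣ g := by
      rw [← Int.pow_dvd_pow_iff (n := 3) (by norm_num)]
      exact ⟨3 * g + T, by rw [hg]; ring⟩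
    obtain ⟨c, rfl⟩ := hdvd
    refine ⟨c, rfl, fun hc => hT ?_, ?_⟩
    · have h : c ^ 3 = 3 * Q * c + T := by
        refine mul_left_cancel₀ hQ0 ?_
        linear_combination hg
      have : T = c ^ 3 - 3 * Q * c := by linear_combination -h
      rw [this]
      exact dvd_sub (dvd_pow hc (by norm_num)) (Dvd.dvd.mul_left hc _)
    · rw [Int.mul_emod, hQ3, one_mul, Int.emod_emod_of_dvd _ (dvd_refl 3)] at hg3
      exact hg3
  have hg2 : g₂ = -g₀ - g₁ := by linear_combination hsum
  have he2 : g₀ ^ 2 + g₀ * g₁ + g₁ ^ 2 = 3 * Q ^ 3 := by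
    rw [hg2] at hsq
    linarith
  have he3 : g₀ * g₁ * g₂ = Q ^ 3 * T := by
    rw [hg2] at hcube ⊢
    linarith
  -- By `he2`, `he3` and the zero sum, the g are the roots of X³ - 3Q³X - Q³T.
  obtain ⟨a₀, rfl, hp0, ha0⟩ := hroot g₀ (by
    rw [hg2] at he3; linear_combination g₀ * he2 + he3) h₀
  obtain ⟨a₁, rfl, hp1, ha1⟩ := hroot g₁ (by
    rw [hg2] at he3; linear_combination g₁ * he2 + he3) h₁
  obtain ⟨a₂, rfl, hp2', ha2⟩ := hroot g₂ (by
    rw [hg2] at he3 ⊢; linear_combination (-Q * a₀ - Q * a₁) * he2 + he3) h₂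
  have hsum' : a₀ + a₁ + a₂ = 0 := by
    refine mul_left_cancel₀ hQpos.ne' ?_
    linear_combination hsum
  have hsq' : a₀ ^ 2 + a₁ ^ 2 + a₂ ^ 2 = 6 * Q := by
    refine mul_left_cancel₀ (pow_ne_zero 2 hQpos.ne') ?_
    linear_combination hsq
  have habs : 0 < a * (a ^ 2 - 81 * b ^ 2) := by
    have hb := abs_nonneg b
    have hfac : a ^ 2 - 81 * b ^ 2 = (a - 9 * |b|) * (a + 9 * |b|) := by
      rw [← sq_abs b]; ring
    rw [hfac]
    rcases hsign with h | ⟨h, h'⟩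
    · exact mul_pos (by linarith) (mul_pos (by linarith) (by linarith))
    · exact mul_pos_of_neg_of_neg h (mul_neg_of_neg_of_pos (by linarith) (by linarith))
  -- With y - z = 9b', the sum and the sum of squares give 4Q = x² + 27b'². Uniqueness yields x² =
  -- a², and x = -a is excluded mod 3.
  have core : ∀ x y z : ℤ, x % 3 = 1 → ¬ (p : ℤ) ∣ x → x + y + z = 0 →
      x ^ 2 + y ^ 2 + z ^ 2 = 6 * Q → 9 ∣ y - z → 0 < x * y * z := by
    rintro x y z hx hpx h1 h2 ⟨b', hb'⟩
    have h3 : 4 * Q = x ^ 2 + 27 * b' ^ 2 := by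
      have e1 : y + z = -x := by linear_combination h1
      have e2 : (y + z) ^ 2 + (y - z) ^ 2 = 2 * (6 * Q - x ^ 2) := by linear_combination 2 * h2
      rw [e1, hb'] at e2
      linarith
    obtain ⟨e1, e2⟩ := sq_eq_sq_of_two_representations hp hp2 hs (by norm_num) (by
      intro X Y h
      by_contra hY
      have : 1 ≤ Y ^ 2 := by have := sq_pos_of_ne_zero hY; omega
      linarith [sq_nonneg X]) h3 hab hpx hpa
    have hxa : x = a := by
      rcases sq_eq_sq_iff_eq_or_eq_neg.mp e1 with h | h
      · exact h
      · omega
    have h4 : 4 * (x * y * z) = a * (a ^ 2 - 81 * b ^ 2) := by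
      have e3 : y + z = -x := by linear_combination h1
      calc 4 * (x * y * z) = x * ((y + z) ^ 2 - (y - z) ^ 2) := by ring
        _ = x * (x ^ 2 - 81 * b' ^ 2) := by rw [e3, hb']; ring
        _ = _ := by rw [e2, hxa]
    linarith
  have hpos : 0 < a₀ * a₁ * a₂ := by
    -- The residues mod 9 lie in {1, 4, 7}; three distinct ones would sum to 12, not to 0 mod 9.
    have h9 : 9 ∣ a₁ - a₂ ∨ 9 ∣ a₀ - a₂ ∨ 9 ∣ a₀ - a₁ := by
      clear * - hsum' ha0 ha1 ha2
      have h1 : a₁ % 9 = 1 ∨ a₁ % 9 = 4 ∨ a₁ % 9 = 7 := by omega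
      have h2 : a₂ % 9 = 1 ∨ a₂ % 9 = 4 ∨ a₂ % 9 = 7 := by omega
      rcases h1 with h1 | h1 | h1 <;> rcases h2 with h2 | h2 | h2 <;> omega
    rcases h9 with h | h | h
    · exact core a₀ a₁ a₂ ha0 hp0 hsum' hsq' h
    · have := core a₁ a₀ a₂ ha1 hp1 (by linarith) (by linarith) h
      linarith
    · have := core a₂ a₀ a₁ ha2 hp2' (by linarith) (by linarith) h
      linarith
  have : Q * a₀ * (Q * a₁) * (Q * a₂) = Q ^ 3 * (a₀ * a₁ * a₂) := by ring
  rw [this]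
  exact mul_pos (pow_pos hQpos 3) hpos

/-- The sign pattern of the quartic exponential sums. -/
theorem quartic_signs {p s : ℕ} (hp : p.Prime) (hp4 : p % 4 = 1) (hs : s ≠ 0)
    {A₁ A₂ B₁ B₂ W c d : ℤ} (hA₁ : A₁ % 4 = 1) (hB₁ : B₁ % 4 = 1)
    (hA : A₁ + A₂ = -2 * ((p : ℤ) ^ s) ^ 2) (hB : B₁ + B₂ = 2 * ((p : ℤ) ^ s) ^ 2)
    (hsq : A₁ ^ 2 + A₂ ^ 2 + B₁ ^ 2 + B₂ ^ 2 = 12 * ((p : ℤ) ^ s) ^ 4)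
    (hcube : A₁ ^ 3 + A₂ ^ 3 + B₁ ^ 3 + B₂ ^ 3 = 4 * ((p : ℤ) ^ s) ^ 4 * W)
    (hW : ¬ (p : ℤ) ∣ W) (hcd : ((p : ℤ) ^ s) ^ 2 = c ^ 2 + 4 * d ^ 2) (hpc : ¬ (p : ℤ) ∣ c)
    (hc : 4 * c ^ 2 < ((p : ℤ) ^ s) ^ 2) (hd : ((p : ℤ) ^ s) ^ 2 < 16 * d ^ 2) :
    A₁ < 0 ∧ A₂ < 0 ∧ B₁ * B₂ < 0 := by
  have hpZ : Prime (p : ℤ) := Nat.prime_iff_prime_int.mp hp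
  have hQ4 : (p : ℤ) ^ s % 4 = 1 := by
    have : (p : ℤ) ≡ 1 [ZMOD 4] := by
      unfold Int.ModEq; omega
    have := this.pow s
    rwa [one_pow] at this
  have hQpos : 0 < (p : ℤ) ^ s := pow_pos (by exact_mod_cast hp.pos) s
  have hcop3 : IsCoprime (((p : ℤ) ^ s) ^ 2) 3 := by
    refine IsCoprime.pow_left (IsCoprime.pow_left ?_)
    rw [hpZ.coprime_iff_not_dvd]
    intro h
    have := (Nat.prime_dvd_prime_iff_eq hp Nat.prime_three).mp (by exact_mod_cast h)
    omega
  have hrep : (1 : ℤ) * (p : ℤ) ^ (s * 2) = c ^ 2 + 4 * d ^ 2 := by rw [one_mul, pow_mul, hcd]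
  have hpQ : (p : ℤ) ∣ (p : ℤ) ^ s := dvd_pow_self _ hs
  have hpow : (p : ℤ) ^ (s * 2) = ((p : ℤ) ^ s) ^ 2 := pow_mul _ _ _
  set Q : ℤ := (p : ℤ) ^ s with hQ
  have hQ2 : Q ^ 2 ≠ 0 := pow_ne_zero 2 hQpos.ne'
  -- Centring each pair at its mean, the moments determine x² and y²; both x and y turn out
  -- divisible by Q, with quotients u and v.
  obtain ⟨x, rfl⟩ : ∃ x, A₁ = -Q ^ 2 + x := ⟨A₁ + Q ^ 2, by ring⟩
  obtain ⟨y, rfl⟩ : ∃ y, B₁ = Q ^ 2 + y := ⟨B₁ - Q ^ 2, by ring⟩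
  obtain rfl : A₂ = -Q ^ 2 - x := by linear_combination hA
  obtain rfl : B₂ = Q ^ 2 - y := by linear_combination hB
  have e1 : x ^ 2 + y ^ 2 = 4 * Q ^ 4 := by linarith
  have e2 : 3 * (y ^ 2 - x ^ 2) = 2 * Q ^ 2 * W := by
    refine mul_left_cancel₀ hQ2 ?_
    linarith
  have hdiv : ∀ z E : ℤ, 3 * z ^ 2 = Q ^ 2 * E → Q ∣ z := by
    intro z E h
    rw [← Int.pow_dvd_pow_iff two_ne_zero]
    exact hcop3.dvd_of_dvd_mul_left ⟨E, h⟩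
  have ex : 3 * x ^ 2 = Q ^ 2 * (6 * Q ^ 2 - W) := by linarith
  have ey : 3 * y ^ 2 = Q ^ 2 * (6 * Q ^ 2 + W) := by linarith
  obtain ⟨u, rfl⟩ := hdiv x _ ex
  obtain ⟨v, rfl⟩ := hdiv y _ ey
  have hu : 3 * u ^ 2 = 6 * Q ^ 2 - W := by
    refine mul_left_cancel₀ hQ2 ?_
    linear_combination ex
  have huv : u ^ 2 + v ^ 2 = 4 * Q ^ 2 := by
    refine mul_left_cancel₀ hQ2 ?_
    linear_combination e1
  -- As Q ≡ 1 mod 4, the congruences for A₁ and B₁ give u ≡ 2 and v ≡ 0 mod 4. Hence u = 2c', v =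
  -- 4d' and c'² + 4d'² = Q².
  have hu4 : u % 4 = 2 := by
    have h : (-Q ^ 2 + Q * u) ≡ -1 ^ 2 + 1 * u [ZMOD 4] :=
      ((Int.ModEq.pow 2 (show Q ≡ 1 [ZMOD 4] from hQ4)).neg).add
        ((show Q ≡ 1 [ZMOD 4] from hQ4).mul_right u)
    have h' : (-Q ^ 2 + Q * u) % 4 = (-1 ^ 2 + 1 * u) % 4 := h
    omega
  have hv4 : v % 4 = 0 := by
    have h : (Q ^ 2 + Q * v) ≡ 1 ^ 2 + 1 * v [ZMOD 4] :=
      (Int.ModEq.pow 2 (show Q ≡ 1 [ZMOD 4] from hQ4)).add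
        ((show Q ≡ 1 [ZMOD 4] from hQ4).mul_right v)
    have h' : (Q ^ 2 + Q * v) % 4 = (1 ^ 2 + 1 * v) % 4 := h
    omega
  obtain ⟨c', rfl⟩ : ∃ c', u = 2 * c' := ⟨u / 2, by omega⟩
  obtain ⟨d', rfl⟩ : ∃ d', v = 4 * d' := ⟨v / 4, by omega⟩
  have hpc' : ¬ (p : ℤ) ∣ c' := by
    intro h
    apply hW
    have : W = 6 * Q ^ 2 - 3 * (2 * c') ^ 2 := by linear_combination hu
    rw [this]
    exact dvd_sub (Dvd.dvd.mul_left (dvd_pow hpQ two_ne_zero) _)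
      (Dvd.dvd.mul_left (dvd_pow (Dvd.dvd.mul_left h _) two_ne_zero) _)
  have hrep' : (1 : ℤ) * (p : ℤ) ^ (s * 2) = c' ^ 2 + 4 * d' ^ 2 := by
    rw [hpow]; linarith
  obtain ⟨f1, f2⟩ := sq_eq_sq_of_two_representations hp (by omega)
    (mul_ne_zero hs two_ne_zero) one_ne_zero (by
      intro X Y h
      by_contra hY
      have : 1 ≤ Y ^ 2 := by have := sq_pos_of_ne_zero hY; omega
      linarith [sq_nonneg X]) hrep' hrep hpc' hpc
  have hlt : |2 * c'| < Q := by
    refine abs_lt_of_sq_lt_sq ?_ hQpos.le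
    rw [mul_pow, f1]; linarith
  rw [abs_lt] at hlt
  refine ⟨?_, ?_, ?_⟩
  · have : -Q ^ 2 + Q * (2 * c') = Q * (2 * c' - Q) := by ring
    rw [this]
    exact mul_neg_of_pos_of_neg hQpos (by linarith)
  · have : -Q ^ 2 - Q * (2 * c') = Q * (-Q - 2 * c') := by ring
    rw [this]
    exact mul_neg_of_pos_of_neg hQpos (by linarith)
  · have : (Q ^ 2 + Q * (4 * d')) * (Q ^ 2 - Q * (4 * d')) = Q ^ 2 * (Q ^ 2 - 16 * d ^ 2) := by
      rw [← f2]; ring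
    rw [this]
    exact mul_neg_of_pos_of_neg (pow_pos hQpos 2) (by linarith)

end Arithmetic

end GPaley

/-! ### The case p ≡ 1 mod k, k ∣ m -/

namespace GPaley

section Main

variable {F : Type*} [Field F] [Fintype F] {p m k n₀ : ℕ}

/-- The number of nonzero `k`-th powers in the field with `p ^ m` elements, where
`p = k * n₀ + 1`. -/
def degree (p m n₀ : ℕ) : ℕ := n₀ * ∑ i ∈ Finset.range m, p ^ i

theorem mul_degree {F : Type*} [Fintype F] (hpk : k * n₀ + 1 = p) (hF : Fintype.card F = p ^ m) :
    k * degree p m n₀ = Fintype.card F - 1 := by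
  have h := geom_sum_mul_add (k * n₀) m
  rw [hpk] at h
  rw [hF, ← h, degree, Nat.add_sub_cancel]
  ring

theorem dvd_degree (hpk : k * n₀ + 1 = p) (hkm : k ∣ m) : p - 1 ∣ degree p m n₀ := by
  have hp1 : p ≡ 1 [MOD k] := by
    rw [← hpk]; simp [Nat.ModEq]
  have h : ∑ i ∈ Finset.range m, p ^ i ≡ 0 [MOD k] := by
    calc ∑ i ∈ Finset.range m, p ^ i ≡ ∑ i ∈ Finset.range m, 1 [MOD k] :=
          Nat.ModEq.sum fun i _ => by simpa using hp1.pow i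
      _ ≡ 0 [MOD k] := by simpa [Nat.modEq_zero_iff_dvd] using hkm
  obtain ⟨t, ht⟩ := Nat.modEq_zero_iff_dvd.mp h
  refine ⟨t, ?_⟩
  rw [degree, ht, ← hpk]
  simp only [Nat.add_sub_cancel]
  ring

/-- An element is a k-th power once its power of exponent (q-1)/k is 1, and p - 1 divides that
exponent because k ∣ m. -/
theorem mem_powerSet_of_pow_eq_one (hpk : k * n₀ + 1 = p) (hkm : k ∣ m)
    (hF : Fintype.card F = p ^ m) {x : F} (hx : x ≠ 0) (hx1 : x ^ (p - 1) = 1) :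
    x ∈ powerSet k F := by
  have hq := Fintype.one_lt_card (α := F)
  have hkn := mul_degree (F := F) hpk hF
  obtain ⟨γ, hγ⟩ := exists_primitiveRoot_card_sub_one F
  obtain ⟨j, -, rfl⟩ := exists_pow_eq hγ hx
  obtain ⟨t, ht⟩ := dvd_degree (m := m) hpk hkm
  rw [mem_powerSet_iff_dvd hγ hkn]
  have h : γ ^ (j * degree p m n₀) = 1 := by rw [ht, pow_mul, pow_mul, hx1, one_pow]
  have h' := hγ.dvd_of_pow_eq_one _ h
  rw [← hkn] at h'
  exact Nat.dvd_of_mul_dvd_mul_right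
    (Nat.pos_of_ne_zero (by intro h0; rw [h0] at hkn; omega)) h'

theorem neg_one_pow_sub_one {R : Type*} [Ring R] (hp : p.Prime) (hk : 2 ≤ k) (hpk : k * n₀ + 1 = p) :
    (-1 : R) ^ (p - 1) = 1 := by
  have : p ≠ 2 := by
    rintro rfl
    have h1 : k * n₀ = 1 := by omega
    have := Nat.eq_one_of_mul_eq_one_right h1
    omega
  exact (hp.even_sub_one this).neg_one_pow

theorem exists_pow_eq_neg_one (hp : p.Prime) (hk : 2 ≤ k) (hpk : k * n₀ + 1 = p) (hkm : k ∣ m)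
    (hF : Fintype.card F = p ^ m) : ∃ ζ : F, ζ ^ k = -1 := by
  obtain ⟨ζ, -, h⟩ := mem_powerSet_of_pow_eq_one hpk hkm hF
    (neg_ne_zero.mpr (one_ne_zero (α := F))) (neg_one_pow_sub_one hp hk hpk)
  exact ⟨ζ, h.symm⟩

theorem natCast_mem_powerSet [CharP F p] (hp : p.Prime) (hpk : k * n₀ + 1 = p)
    (hkm : k ∣ m) (hF : Fintype.card F = p ^ m) (j : ℕ) (hj : (j : F) ≠ 0) :
    (j : F) ∈ powerSet k F := by
  refine mem_powerSet_of_pow_eq_one hpk hkm hF hj ?_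
  have : Fact p.Prime := ⟨hp⟩
  have h : (j : ZMod p) ≠ 0 := by
    rwa [Ne, ZMod.natCast_eq_zero_iff, ← CharP.cast_eq_zero_iff F p]
  have := congrArg (ZMod.castHom (dvd_refl p) F) (ZMod.pow_card_sub_one_eq_one h)
  simpa using this

/-- The nontrivial eigenvalues of the generalized Paley graph are integers, and their first three
power sums over a set of representatives are known. -/
theorem exists_int_eigenvalues [CharP F p] (hp : p.Prime) (hk : 2 ≤ k) (hpk : k * n₀ + 1 = p)
    (hkm : k ∣ m) (hF : Fintype.card F = p ^ m) {ψ : AddChar F ℂ} (hψ : ψ.IsPrimitive) {γ : F}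
    (hγ : IsPrimitiveRoot γ (Fintype.card F - 1)) :
    ∃ η : F → ℤ, (∀ c, charSum ψ (powerSet k F) c = η c) ∧ (∀ c, η (c * γ ^ k) = η c) ∧
      ∑ i ∈ Finset.range k, (1 + k * η (γ ^ i)) = 0 ∧
      ∑ i ∈ Finset.range k, (1 + k * η (γ ^ i)) ^ 2 = k * (k - 1) * (p : ℤ) ^ m ∧
      ∑ i ∈ Finset.range k, (1 + k * η (γ ^ i)) ^ 3
        = k * (p : ℤ) ^ m * (fermatCount k F - (p : ℤ) ^ m - 1 + k) := by
  have hk0 : 0 < k := by omega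
  have hkn := mul_degree (F := F) hpk hF
  choose η hη using exists_int_charSum hp hk0 hkn (natCast_mem_powerSet hp hpk hkm hF) ψ
  have hpow : ∀ c, powerSum ψ k c = ((1 + k * η c : ℤ) : ℂ) := by
    intro c
    rw [powerSum_eq hk0 hkn, hη]
    push_cast; ring
  obtain ⟨ζ, hζ⟩ := exists_pow_eq_neg_one hp hk hpk hkm hF
  obtain ⟨h1, h2, h3⟩ := sum_range_powerSum hψ hγ hk0 hkn hζ
  simp only [hpow, hF] at h1 h2 h3
  refine ⟨η, hη, fun c => ?_, by exact_mod_cast h1, by exact_mod_cast h2, by exact_mod_cast h3⟩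
  have h := powerSum_mul_pow ψ k c (primitiveRoot_ne_zero hγ)
  rw [hpow, hpow, Int.cast_inj] at h
  have hkZ : (k : ℤ) ≠ 0 := by exact_mod_cast hk0.ne'
  exact mul_left_cancel₀ hkZ (add_left_cancel h)

/-- Each coset of R_k has as many elements as R_k, so one nonnegative period gives exactly the count
needed in `triple_of_ncard_nonneg`. -/
theorem triple_of_sum_eq_one [CharP F p] (hp : p.Prime) (hk : 3 ≤ k) (hpk : k * n₀ + 1 = p)
    (hkm : k ∣ m) (hF : Fintype.card F = p ^ m) {ψ : AddChar F ℂ} (hψ : ψ.IsPrimitive) {γ : F}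
    (hγ : IsPrimitiveRoot γ (Fintype.card F - 1)) {η : F → ℤ}
    (hη : ∀ c, charSum ψ (powerSet k F) c = η c) (hinv : ∀ c, η (c * γ ^ k) = η c)
    (hone : (∑ i ∈ Finset.range k, if 0 ≤ η (γ ^ i) then 1 else 0) = 1) :
    TripleEquienergeticNonIsospectral k F := by
  classical
  have hk0 : 0 < k := by omega
  have hq := Fintype.one_lt_card (α := F)
  have hkn := mul_degree (F := F) hpk hF
  have hcard : (powerSet k F).ncard = degree p m n₀ := ncard_powerSet hk0 hkn
  have hγ0 := primitiveRoot_ne_zero hγ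
  refine triple_of_ncard_nonneg hψ ?_ ⟨1, 1, one_ne_zero, by simp⟩ (zero_notMem_powerSet k F) ?_
    ?_ η (fun c _ => hη c) ?_
  · have h2 : ((2 : ℕ) : F) ≠ 0 := by
      rw [Ne, CharP.cast_eq_zero_iff F p]
      intro h
      have hp2 := (Nat.prime_dvd_prime_iff_eq hp Nat.prime_two).mp h
      have h1 : k * n₀ = 1 := by omega
      have := Nat.eq_one_of_mul_eq_one_right h1
      omega
    exact_mod_cast h2
  · rintro s ⟨x, hx, rfl⟩
    obtain ⟨ζ, hζ⟩ := exists_pow_eq_neg_one (k := k) (F := F) hp (by omega) hpk hkm hF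
    have hζ0 : ζ ≠ 0 := by rintro rfl; simp [zero_pow hk0.ne'] at hζ
    exact ⟨ζ * x, mul_ne_zero hζ0 hx, by rw [mul_pow, hζ]; ring⟩
  · rw [hcard]
    have h1 : 3 * degree p m n₀ ≤ k * degree p m n₀ := Nat.mul_le_mul_right _ hk
    have h2 : degree p m n₀ ≠ 0 := by intro h0; rw [h0] at hkn; omega
    omega
  · have h := sum_eq_of_coset_invariant hγ hkn (f := fun c => if c ≠ 0 ∧ 0 ≤ η c then 1 else 0)
      (fun c => by simp only [hinv, ne_eq, mul_eq_zero, pow_ne_zero k hγ0, or_false])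
    simp only [ne_eq, not_true_eq_false, false_and, if_false, pow_ne_zero _ hγ0,
      not_false_eq_true, true_and, hone, zero_add] at h
    rw [hcard, ← card_filter_mem, Finset.card_filter]
    simpa using h

theorem fermatCount_three_cast [CharP F p] (hp : p.Prime) (hpk : 3 * n₀ + 1 = p) (hkm : 3 ∣ m)
    (hF : Fintype.card F = p ^ m) :
    (fermatCount 3 F : F) = -(2 + ((2 * n₀).choose n₀ : F) ^ m) := by
  have hkn := mul_degree (F := F) hpk hF
  obtain ⟨t, ht⟩ := dvd_degree (m := m) hpk hkm
  rw [fermatCount_cast (by norm_num) hkn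
    (by rw [ht, pow_mul, neg_one_pow_sub_one hp (by norm_num) hpk, one_pow])]
  have h := cast_choose_mul_geomSum (F := F) hp (a := 2 * n₀) (b := n₀) (by omega) (by omega) m
  rw [mul_assoc] at h
  simp [Finset.sum_range_succ, degree, h]
  ring

/-- Three of the six binomial coefficients are 1. The other three agree in F by symmetry and
`cast_choose_three_mul`, whose sign disappears because m is even. -/
theorem fermatCount_four_cast [CharP F p] (hp : p.Prime) (hpk : 4 * n₀ + 1 = p) (hkm : 4 ∣ m)
    (hF : Fintype.card F = p ^ m) :
    (fermatCount 4 F : F) = -(3 + 3 * ((2 * n₀).choose n₀ : F) ^ m) := by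
  have hkn := mul_degree (F := F) hpk hF
  obtain ⟨t, ht⟩ := dvd_degree (m := m) hpk hkm
  rw [fermatCount_cast (by norm_num) hkn
    (by rw [ht, pow_mul, neg_one_pow_sub_one hp (by norm_num) hpk, one_pow])]
  have h := cast_choose_mul_geomSum (F := F) hp (a := 2 * n₀) (b := n₀) (by omega) (by omega) m
  have h' := cast_choose_mul_geomSum (F := F) hp (a := 3 * n₀) (b := n₀) (by omega) (by omega) m
  have h'' := cast_choose_mul_geomSum (F := F) hp (a := 3 * n₀) (b := 2 * n₀) (by omega)
    (by omega) m
  have hsymm : (3 * n₀).choose (2 * n₀) = (3 * n₀).choose n₀ := by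
    rw [← Nat.choose_symm_of_eq_add]; ring
  have heven : (-1 : F) ^ m = 1 :=
    Even.neg_one_pow (by obtain ⟨r, rfl⟩ := hkm; exact ⟨2 * r, by ring⟩)
  rw [hsymm] at h''
  rw [cast_choose_three_mul hp hpk, mul_pow, ← pow_mul, mul_comm n₀ m, pow_mul, heven, one_pow,
    one_mul] at h' h''
  simp only [mul_assoc] at h h' h''
  simp [Finset.sum_range_succ, degree, h, h', h'']
  ring

theorem sum_range_two_mul {M : Type*} [AddCommMonoid M] (f : ℕ → M) (n : ℕ) :
    ∑ j ∈ Finset.range (2 * n), f j = ∑ j ∈ Finset.range n, (f (2 * j) + f (2 * j + 1)) := by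
  induction n with
  | zero => simp
  | succ n ih =>
    rw [Nat.mul_succ, Finset.sum_range_succ, Finset.sum_range_succ, ih, Finset.sum_range_succ,
      add_assoc]

/-- Nonzero squares are the fourth powers and their multiples by the square of a generator. -/
theorem charSum_two_eq {n : ℕ} (ψ : AddChar F ℂ) {γ : F}
    (hγ : IsPrimitiveRoot γ (Fintype.card F - 1)) (hn : 4 * n = Fintype.card F - 1) (c : F) :
    charSum ψ (powerSet 2 F) c
      = charSum ψ (powerSet 4 F) c + charSum ψ (powerSet 4 F) (c * γ ^ 2) := by
  classical
  rw [charSum_eq_sum, charSum_eq_sum, charSum_eq_sum,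
    sum_powerSet hγ two_pos (n := 2 * n) (by omega) (fun s => ψ (c * s)),
    sum_powerSet hγ four_pos hn (fun s => ψ (c * s)),
    sum_powerSet hγ four_pos hn (fun s => ψ (c * γ ^ 2 * s)), sum_range_two_mul,
    Finset.sum_add_distrib]
  congr 1 <;> refine Finset.sum_congr rfl fun j _ => ?_ <;> congr 1 <;> ring

theorem exists_isPrimitive (F : Type*) [Field F] [Fintype F] : ∃ ψ : AddChar F ℂ, ψ.IsPrimitive := by
  obtain ⟨ψ, hψ⟩ := AddChar.exists_apply_ne_zero.mpr (one_ne_zero (α := F))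
  exact ⟨ψ, AddChar.IsPrimitive.of_ne_one (AddChar.ne_one_iff.mpr ⟨1, hψ⟩)⟩

theorem one_pos_of_sum_eq_zero {x y z : ℤ} (hsum : x + y + z = 0) (hprod : 0 < x * y * z) :
    (0 < x ∧ y < 0 ∧ z < 0) ∨ (x < 0 ∧ 0 < y ∧ z < 0) ∨ (x < 0 ∧ y < 0 ∧ 0 < z) := by
  rcases mul_pos_iff.mp hprod with ⟨h, hz⟩ | ⟨h, hz⟩
  · rcases mul_pos_iff.mp h with ⟨hx, hy⟩ | ⟨hx, hy⟩ <;> omega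
  · rcases mul_neg_iff.mp h with ⟨hx, hy⟩ | ⟨hx, hy⟩ <;> omega

theorem triple_three [CharP F p] {s : ℕ} (hp : p.Prime) (hpk : 3 * n₀ + 1 = p) (hs : s ≠ 0)
    (hF : Fintype.card F = p ^ (s * 3)) {a b : ℤ} (hab : 4 * (p : ℤ) ^ s = a ^ 2 + 27 * b ^ 2)
    (ha : a ≡ 1 [ZMOD 3]) (hpa : IsCoprime a (p : ℤ))
    (hsign : a > 9 * |b| ∨ (a < 0 ∧ -a < 9 * |b|)) :
    TripleEquienergeticNonIsospectral 3 F := by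
  obtain ⟨ψ, hψ⟩ := exists_isPrimitive F
  obtain ⟨γ, hγ⟩ := exists_primitiveRoot_card_sub_one F
  have hkm : 3 ∣ s * 3 := dvd_mul_left 3 s
  obtain ⟨η, hη, hinv, h1, h2, h3⟩ :=
    exists_int_eigenvalues hp (by norm_num) hpk hkm hF hψ hγ
  refine triple_of_sum_eq_one hp le_rfl hpk hkm hF hψ hγ hη hinv ?_
  have hpZ : Prime (p : ℤ) := Nat.prime_iff_prime_int.mp hp
  -- Modulo p this is minus a power of a binomial coefficient with entries below p, hence nonzero.
  have hT : ¬ (p : ℤ) ∣ fermatCount 3 F - (p : ℤ) ^ (s * 3) + 2 := by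
    rw [← CharP.intCast_eq_zero_iff F p]
    push_cast
    rw [fermatCount_three_cast hp hpk hkm hF, CharP.cast_eq_zero F p,
      zero_pow (mul_ne_zero hs three_ne_zero)]
    intro h
    refine pow_ne_zero (s * 3) (cast_choose_ne_zero (F := F) hp (a := 2 * n₀) (b := n₀)
      (by omega) (by omega)) ?_
    linear_combination -h
  have hpa' : ¬ (p : ℤ) ∣ a := hpZ.coprime_iff_not_dvd.mp hpa.symm
  rw [pow_mul] at h2 h3 hT
  simp only [Finset.sum_range_succ, Finset.sum_range_zero, zero_add] at h1 h2 h3 ⊢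
  push_cast at h1 h2 h3
  have hpos := cubic_prod_pos hp (by omega) (by rintro rfl; omega) hs
    (g₀ := 1 + 3 * η (γ ^ 0)) (g₁ := 1 + 3 * η (γ ^ 1)) (g₂ := 1 + 3 * η (γ ^ 2))
    (by omega) (by omega) (by omega) h1 (by linarith)
    (T := fermatCount 3 F - ((p : ℤ) ^ s) ^ 3 + 2) (by linarith) hT hab ha hpa' hsign
  rcases one_pos_of_sum_eq_zero h1 hpos with ⟨x, y, z⟩ | ⟨x, y, z⟩ | ⟨x, y, z⟩
  · rw [if_pos (by omega), if_neg (by omega), if_neg (by omega)]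
  · rw [if_neg (by omega), if_pos (by omega), if_neg (by omega)]
  · rw [if_neg (by omega), if_neg (by omega), if_pos (by omega)]

theorem triple_four [CharP F p] {s : ℕ} (hp : p.Prime) (hpk : 4 * n₀ + 1 = p) (hs : s ≠ 0)
    (hF : Fintype.card F = p ^ (s * 4)) {c d : ℤ} (hcd : ((p : ℤ) ^ s) ^ 2 = c ^ 2 + 4 * d ^ 2)
    (hpc : IsCoprime c (p : ℤ))
    (hc : 4 * c ^ 2 < ((p : ℤ) ^ s) ^ 2) (hd : ((p : ℤ) ^ s) ^ 2 < 16 * d ^ 2) :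
    TripleEquienergeticNonIsospectral 4 F := by
  obtain ⟨ψ, hψ⟩ := exists_isPrimitive F
  obtain ⟨γ, hγ⟩ := exists_primitiveRoot_card_sub_one F
  have hkm : 4 ∣ s * 4 := dvd_mul_left 4 s
  have hkm2 : 2 ∣ s * 4 := ⟨s * 2, by ring⟩
  have hpk2 : 2 * (2 * n₀) + 1 = p := by omega
  obtain ⟨η, hη, hinv, h1, h2, h3⟩ :=
    exists_int_eigenvalues hp (by norm_num) hpk hkm hF hψ hγ
  obtain ⟨θ, hθ, -, k1, k2, -⟩ :=
    exists_int_eigenvalues hp (by norm_num) hpk2 hkm2 hF hψ hγ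
  refine triple_of_sum_eq_one hp (by norm_num) hpk hkm hF hψ hγ hη hinv ?_
  have hpZ : Prime (p : ℤ) := Nat.prime_iff_prime_int.mp hp
  have hW : ¬ (p : ℤ) ∣ fermatCount 4 F - (p : ℤ) ^ (s * 4) + 3 := by
    rw [← CharP.intCast_eq_zero_iff F p]
    push_cast
    rw [fermatCount_four_cast hp hpk hkm hF, CharP.cast_eq_zero F p,
      zero_pow (mul_ne_zero hs four_ne_zero)]
    intro h
    have h3 : ((3 : ℕ) : F) ≠ 0 := by
      rw [Ne, CharP.cast_eq_zero_iff F p]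
      intro h
      have := (Nat.prime_dvd_prime_iff_eq hp Nat.prime_three).mp h
      omega
    refine mul_ne_zero h3 (pow_ne_zero (s * 4) (cast_choose_ne_zero (F := F) hp (a := 2 * n₀)
      (b := n₀) (by omega) (by omega))) ?_
    push_cast
    linear_combination -h
  have hsplit : ∀ c, θ c = η c + η (c * γ ^ 2) := by
    intro c
    have := charSum_two_eq ψ hγ (mul_degree hpk hF) c
    rw [hθ, hη, hη] at this
    exact_mod_cast this
  have hpc' : ¬ (p : ℤ) ∣ c := hpZ.coprime_iff_not_dvd.mp hpc.symm
  have e0 := hsplit (γ ^ 0)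
  have e1 := hsplit (γ ^ 1)
  rw [← pow_add, zero_add] at e0
  rw [← pow_add] at e1
  rw [pow_mul] at h2 h3 k2 hW
  simp only [Finset.sum_range_succ, Finset.sum_range_zero, zero_add] at h1 h2 h3 k1 k2 ⊢
  push_cast at h1 h2 h3 k1 k2
  have hp4 : p % 4 = 1 := by omega
  -- The two quadratic values 1 + 2θ are opposite and their squares sum to 2q, so they are ±Q² with
  -- Q = p^s. This fixes the sums of the two pairs of quartic values; the sign only decides which
  -- pair is which.
  have hk : (1 + 2 * θ (γ ^ 0)) ^ 2 = (((p : ℤ) ^ s) ^ 2) ^ 2 := by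
    have : 1 + 2 * θ (γ ^ 1) = -(1 + 2 * θ (γ ^ 0)) := by linarith
    rw [this] at k2
    linarith
  rcases sq_eq_sq_iff_eq_or_eq_neg.mp hk with hθ0 | hθ0
  · obtain ⟨x, y, z⟩ := quartic_signs hp hp4 hs
      (A₁ := 1 + 4 * η (γ ^ 1)) (A₂ := 1 + 4 * η (γ ^ 3))
      (B₁ := 1 + 4 * η (γ ^ 0)) (B₂ := 1 + 4 * η (γ ^ 2))
      (by omega) (by omega) (by linarith) (by linarith) (by linarith)
      (W := fermatCount 4 F - ((p : ℤ) ^ s) ^ 4 + 3) (by linarith) hW hcd hpc' hc hd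
    rw [if_neg (by omega : ¬ 0 ≤ η (γ ^ 1)), if_neg (by omega : ¬ 0 ≤ η (γ ^ 3))]
    rcases mul_neg_iff.mp z with ⟨z, w⟩ | ⟨z, w⟩
    · rw [if_pos (by omega), if_neg (by omega)]
    · rw [if_neg (by omega), if_pos (by omega)]
  · obtain ⟨x, y, z⟩ := quartic_signs hp hp4 hs
      (A₁ := 1 + 4 * η (γ ^ 0)) (A₂ := 1 + 4 * η (γ ^ 2))
      (B₁ := 1 + 4 * η (γ ^ 1)) (B₂ := 1 + 4 * η (γ ^ 3))
      (by omega) (by omega) (by linarith) (by linarith) (by linarith)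
      (W := fermatCount 4 F - ((p : ℤ) ^ s) ^ 4 + 3) (by linarith) hW hcd hpc' hc hd
    rw [if_neg (by omega : ¬ 0 ≤ η (γ ^ 0)), if_neg (by omega : ¬ 0 ≤ η (γ ^ 2))]
    rcases mul_neg_iff.mp z with ⟨z, w⟩ | ⟨z, w⟩
    · rw [if_pos (by omega), if_neg (by omega)]
    · rw [if_neg (by omega), if_pos (by omega)]

end Main

end GPaley

/-! ### Reduction of the hypotheses and the main theorem -/

namespace GPaley

/-- Modulo k the sum alternates, and it equals 1 when m is odd. -/
theorem geomSum_modEq_neg_one {k p m : ℕ} (hk : 2 ≤ k) (h : (p : ℤ) ≡ -1 [ZMOD k])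
    (hdvd : k ∣ ∑ i ∈ Finset.range m, p ^ i) : Even m := by
  by_contra hm
  have h1 : (∑ i ∈ Finset.range m, (p : ℤ) ^ i) ≡ ∑ i ∈ Finset.range m, (-1) ^ i [ZMOD k] :=
    Int.ModEq.sum fun i _ => h.pow i
  have h0 : (∑ i ∈ Finset.range m, (p : ℤ) ^ i) ≡ 0 [ZMOD k] :=
    Int.modEq_zero_iff_dvd.mpr (by exact_mod_cast hdvd)
  have h2 := h0.symm.trans h1
  rw [neg_one_geom_sum, if_neg hm] at h2
  have h3 := Int.modEq_zero_iff_dvd.mp h2.symm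
  have := Int.le_of_dvd one_pos h3
  omega

theorem dvd_of_dvd_geomSum {k p m : ℕ} (h : p ≡ 1 [MOD k])
    (hdvd : k ∣ ∑ i ∈ Finset.range m, p ^ i) : k ∣ m := by
  have h1 : (∑ i ∈ Finset.range m, p ^ i) ≡ ∑ i ∈ Finset.range m, 1 ^ i [MOD k] :=
    Nat.ModEq.sum fun i _ => h.pow i
  have h2 := (Nat.modEq_zero_iff_dvd.mpr hdvd).symm.trans h1
  exact Nat.modEq_zero_iff_dvd.mp (by simpa using h2.symm)

theorem not_dvd_geomSum {k p m : ℕ} (hk : k ≠ 1) (hm : 1 ≤ m) (h : k ∣ p) :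
    ¬ k ∣ ∑ i ∈ Finset.range m, p ^ i := by
  obtain ⟨m, rfl⟩ := Nat.exists_eq_succ_of_ne_zero (by omega : m ≠ 0)
  rw [geom_sum_succ]
  intro hd
  exact hk (Nat.dvd_one.mp ((Nat.dvd_add_right (h.mul_right _)).mp hd))

/-- Outside of the semiprimitive case and one sporadic field, the hypothesis on `(q - 1) / (p - 1)`
means `p ≡ 1` modulo `k` and `k ∣ m`. -/
theorem modEq_one_or_exceptional {k p m : ℕ} (hm : 1 ≤ m)
    (hdvd : k ∣ ∑ i ∈ Finset.range m, p ^ i) (hns : ¬ IsSemiprimitivePair k p m) (hk : 2 ≤ k)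
    (hres : p % k = 1 ∨ k ∣ p + 1) :
    (∃ n₀, k * n₀ + 1 = p) ∧ (∃ s ≠ 0, m = s * k) ∨ Even m ∧ p ^ (m / 2) + 1 = k := by
  rcases hres with h | h
  · left
    obtain ⟨s, rfl⟩ := dvd_of_dvd_geomSum (k := k) (p := p)
      (by rw [Nat.ModEq, h, Nat.mod_eq_of_lt (by omega)]) hdvd
    refine ⟨⟨p / k, ?_⟩, s, ?_, mul_comm _ _⟩
    · have := Nat.div_add_mod p k
      omega
    · rintro rfl; simp at hm
  · right
    have hp : (p : ℤ) ≡ -1 [ZMOD k] := by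
      refine (Int.modEq_iff_dvd.mpr ?_).symm
      rw [sub_neg_eq_add]
      exact_mod_cast h
    have he := geomSum_modEq_neg_one hk hp hdvd
    refine ⟨he, ?_⟩
    by_contra hne
    -- The exponent t = 1 witnesses semiprimitivity.
    exact hns ⟨⟨1, le_rfl, by simpa using he.two_dvd, by simpa using h⟩, fun h => hne h.symm⟩

theorem pow_eq_prime {p e r : ℕ} (hr : r.Prime) (h : p ^ e = r) : p = r ∧ e = 1 := by
  have he : e = 1 := Nat.Prime.eq_one_of_pow (h ▸ hr)
  subst he
  exact ⟨by simpa using h, rfl⟩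

theorem rpow_one_div_of_pow {x : ℝ} (hx : 0 ≤ x) {k : ℕ} (hk : k ≠ 0) :
    (x ^ k) ^ (1 / k : ℝ) = x := by
  rw [one_div, Real.pow_rpow_inv_natCast hx hk]

end GPaley

theorem corollary4p3 (p m q : ℕ) (hp : p.Prime) (hm : 1 ≤ m) (hq : q = p ^ m)
    (F : Type*) [Field F] [Fintype F] (hF : Fintype.card F = q) :
    (3 ∣ (q - 1) / (p - 1) → ¬ GPaley.IsSemiprimitivePair 3 p m →
      ∀ a b : ℤ, 4 * (q : ℝ) ^ (1 / 3 : ℝ) = (a : ℝ) ^ 2 + 27 * (b : ℝ) ^ 2 →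
        a ≡ 1 [ZMOD 3] → IsCoprime a (p : ℤ) →
        (a > 9 * |b| ∨ (a < 0 ∧ -a < 9 * |b|)) →
        GPaley.TripleEquienergeticNonIsospectral 3 F) ∧
    (4 ∣ (q - 1) / (p - 1) → ¬ GPaley.IsSemiprimitivePair 4 p m →
      ∀ c d : ℤ, Real.sqrt (q : ℝ) = (c : ℝ) ^ 2 + 4 * (d : ℝ) ^ 2 →
        c ≡ 1 [ZMOD 4] → IsCoprime c (p : ℤ) →
        ((2 * |(c : ℝ)| < (q : ℝ) ^ (1 / 4 : ℝ) ∧ (q : ℝ) ^ (1 / 4 : ℝ) < 4 * |(d : ℝ)| →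
          GPaley.TripleEquienergeticNonIsospectral 4 F) ∧
         (|(c : ℝ)| < 2 * Real.sqrt 3 / 3 * |(d : ℝ)| →
          GPaley.TripleEquienergeticNonIsospectral 4 F))) := by
  have : Fact p.Prime := ⟨hp⟩
  have hcharP : CharP F p := charP_of_card_eq_prime_pow (hF.trans hq)
  subst hq
  rw [← Nat.geomSum_eq hp.two_le]
  constructor
  · intro hdvd hns a b hab ha hpa hsign
    have hres : p % 3 = 1 ∨ 3 ∣ p + 1 := by
      have h3 : ¬ 3 ∣ p := fun h => GPaley.not_dvd_geomSum (k := 3) (p := p) (by norm_num) hm h hdvd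
      omega
    rcases GPaley.modEq_one_or_exceptional hm hdvd hns (by norm_num) hres with
      ⟨⟨n₀, hpk⟩, s, hs, rfl⟩ | ⟨he, h⟩
    · refine GPaley.triple_three hp hpk hs hF ?_ ha hpa hsign
      have hroot := GPaley.rpow_one_div_of_pow (x := (p : ℝ) ^ s) (by positivity) three_ne_zero
      rw [Nat.cast_pow, pow_mul] at hab
      rw [Nat.cast_ofNat] at hroot
      rw [hroot] at hab
      exact_mod_cast hab
    · exfalso
      obtain ⟨rfl, hm1⟩ := GPaley.pow_eq_prime Nat.prime_two (by omega : p ^ (m / 2) = 2)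
      obtain ⟨r, rfl⟩ := he
      obtain rfl : r = 1 := by omega
      -- Here q = 4, and a² + 27b² would be an integer with cube 4³ · 4 = 256.
      have hcube : (((2 ^ (1 + 1) : ℕ) : ℝ) ^ (1 / 3 : ℝ)) ^ 3 = 4 := by
        rw [← Real.rpow_natCast, ← Real.rpow_mul (by positivity)]
        norm_num
      have hZ : (a ^ 2 + 27 * b ^ 2) ^ 3 = 256 := by
        have : ((a : ℝ) ^ 2 + 27 * (b : ℝ) ^ 2) ^ 3 = 256 := by
          rw [← hab, mul_pow, hcube]; norm_num
        exact_mod_cast this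
      have h0 : 0 ≤ a ^ 2 + 27 * b ^ 2 := by positivity
      generalize a ^ 2 + 27 * b ^ 2 = z at hZ h0
      have h7 : z < 7 := by
        by_contra h
        have := pow_le_pow_left₀ (by norm_num) (not_lt.mp h) 3
        omega
      interval_cases z <;> omega
  · intro hdvd hns c d hcd hc hpc
    have hres : p % 4 = 1 ∨ 4 ∣ p + 1 := by
      have h2 : ¬ 2 ∣ p := fun h => GPaley.not_dvd_geomSum (k := 2) (p := p) (by norm_num) hm h
        (dvd_trans (by norm_num) hdvd)
      omega
    rcases GPaley.modEq_one_or_exceptional hm hdvd hns (by norm_num) hres with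
      ⟨⟨n₀, hpk⟩, s, hs, rfl⟩ | ⟨he, h⟩
    · have hroot := GPaley.rpow_one_div_of_pow (x := (p : ℝ) ^ s) (by positivity) four_ne_zero
      rw [Nat.cast_ofNat] at hroot
      have hQ : (0 : ℝ) < (p : ℝ) ^ s := pow_pos (by exact_mod_cast hp.pos) s
      have hsqrt : √(((p : ℝ) ^ s) ^ 4) = ((p : ℝ) ^ s) ^ 2 := by
        rw [show ((p : ℝ) ^ s) ^ 4 = (((p : ℝ) ^ s) ^ 2) ^ 2 by ring]
        exact Real.sqrt_sq (by positivity)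
      rw [Nat.cast_pow, pow_mul] at hcd ⊢
      rw [hsqrt] at hcd
      rw [hroot]
      have hcdZ : ((p : ℤ) ^ s) ^ 2 = c ^ 2 + 4 * d ^ 2 := by exact_mod_cast hcd
      have main : 4 * (c : ℝ) ^ 2 < ((p : ℝ) ^ s) ^ 2 → ((p : ℝ) ^ s) ^ 2 < 16 * (d : ℝ) ^ 2 →
          GPaley.TripleEquienergeticNonIsospectral 4 F := fun h1 h2 =>
        GPaley.triple_four hp hpk hs hF hcdZ hpc (by exact_mod_cast h1) (by exact_mod_cast h2)
      constructor
      · rintro ⟨h1, h2⟩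
        have h1' := pow_lt_pow_left₀ h1 (by positivity) two_ne_zero
        have h2' := pow_lt_pow_left₀ h2 hQ.le two_ne_zero
        rw [mul_pow, sq_abs] at h1' h2'
        exact main (by linarith) (by linarith)
      -- Squaring gives 3c² < 4d². With Q² = c² + 4d² this is 4c² < Q², and it also implies Q² <
      -- 16d².
      · intro h
        have h' := pow_lt_pow_left₀ h (abs_nonneg _) two_ne_zero
        rw [mul_pow, div_pow, mul_pow, Real.sq_sqrt (by norm_num), sq_abs, sq_abs] at h'
        exact main (by linarith) (by linarith [sq_nonneg (c : ℝ)])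
    · exfalso
      obtain ⟨rfl, hm1⟩ := GPaley.pow_eq_prime Nat.prime_three (by omega : p ^ (m / 2) = 3)
      obtain ⟨r, rfl⟩ := he
      obtain rfl : r = 1 := by omega
      -- Here q = 9, and 3 = c² + 4d² contradicts c² ≡ 1 mod 4.
      have h3 : √((3 ^ (1 + 1) : ℕ) : ℝ) = 3 := by
        rw [Nat.cast_pow]
        exact Real.sqrt_sq (by norm_num)
      rw [h3] at hcd
      have hZ : 3 = c ^ 2 + 4 * d ^ 2 := by exact_mod_cast hcd
      have h1 : c ^ 2 % 4 = 1 := hc.pow 2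
      omega
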